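/- Let $R$ be an associative unital ring that is right coherent (every finitely generated right ideal is finitely presented). Write $\mathrm{Mod}\text{-}R$ for the category of right $R$-modules and $\mathrm{mod}\text{-}R$ for its full subcategory of finitely presented modules, which is abelian. All subcategories are full. \textbf{Notation.} In an abelian category $\mathcal A$: for an object $V$, $\mathrm{Add}(V)$ (resp. $\mathrm{add}(V)$) is the class of direct summands of (resp. finite) coproducts of copies of $V$; $\mathrm{Gen}(V)$ is the class of quotients of objects of $\mathrm{Add}(V)$; $\mathrm{Pres}(V)$ (resp. $\mathrm{pres}(V)$) is the class of cokernels of morphisms in $\mathrm{Add}(V)$ (resp. $\mathrm{add}(V)$); $\overline{\mathrm{Gen}}(V)$ is the class of subobjects of objects of $\mathrm{Gen}(V)$; $V^{\perp}=\{Y:\mathrm{Hom}(V,Y)=0\}$, $V^{\perp_1}=\{Y:\mathrm{Ext}^1(V,Y)=0\}$, and ${}^{\perp_1}\mathcal T=\{X:\mathrm{Ext}^1(X,T)=0\ \forall\, T\in\mathcal T\}$. A torsion pair is a pair $(\mathcal T,\mathcal F)$ of classes with $\mathcal F=\{Y:\mathrm{Hom}(T,Y)=0\ \forall\,T\in\mathcal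 T\}$, $\mathcal T=\{X:\mathrm{Hom}(X,F)=0\ \forall\,F\in\mathcal F\}$, and such that every $A$ fits in a short exact sequence $0\to T\to A\to F\to 0$ with $T\in\mathcal T$, $F\in\mathcal F$; then $\mathcal T$ is a torsion class. An object $V$ is quasi-tilting if $\mathrm{Gen}(V)=\mathrm{Pres}(V)=\overline{\mathrm{Gen}}(V)\cap V^{\perp_1}$ and this class is a torsion class. A class $\mathcal T$ is cogenerating if every object embeds in an object of $\mathcal T$. A $\mathcal T$-preenvelope of $M$ is a morphism $\varphi:M\to X$ with $X\in\mathcal T$ through which every morphism from $M$ to an object of $\mathcal T$ factors; it is semi-special if $\mathrm{Coker}(\varphi)\in{}^{\perp_1}\mathcal T$, special if it is moreover a monomorphism, and a $\mathcal T$-preenvelope is an envelope if every $\psi:X\to X$ with $\psi\varphi=\varphi$ is an isomorphism. The class $\mathcal T$ is preenveloping (semi-special preenveloping, special preenveloping, enveloping) if every object of $\mathcal A$ has such a $\mathcal T$-preenvelope. For right $R$-modules, $\mathrm{Add},\mathrm{add},\mathrm{Gen},\mathrm{Pres},\mathrm{pres},\overline{\mathrm{Gen}}$, $(-)^{\perp}$,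 $(-)^{\perp_1}$ and quasi-tilting are meant in $\mathrm{Mod}\text{-}R$. A right $R$-module $V$ is finendo if it is finitely generated as a left $\mathrm{End}_R(V)$-module. It is classical tilting if (1) there is a short exact sequence $0\to P_1\to P_0\to V\to 0$ with $P_0,P_1$ finitely generated projective; (2) $\mathrm{Ext}^1_R(V,V)=0$; (3) there is a short exact sequence $0\to R\to V_0\to V_1\to 0$ with $V_0,V_1\in\mathrm{add}(V)$. The torsion pair of $V$, $(\mathrm{Gen}(V),V^\perp)$, restricts to $\mathrm{mod}\text{-}R$ if $(\mathrm{Gen}(V)\cap\mathrm{mod}\text{-}R,\ V^\perp\cap\mathrm{mod}\text{-}R)$ is a torsion pair in $\mathrm{mod}\text{-}R$. Two such modules $V,V'$ are equivalent if $\mathrm{Add}(V)=\mathrm{Add}(V')$, and $[V]$ denotes the equivalence class of $V$. \textbf{Proposition.} (a) The assignment $[V]\mapsto\mathrm{pres}(V)$ is a well-defined bijection from the equivalence classes of finitely presented finendo quasi-tilting right $R$-modules $V$ whose torsion pair restricts to $\mathrm{mod}\text{-}R$ onto the semi-special preenveloping torsion classes in $\mathrm{mod}\text{-}R$. (b) The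 assignment $[V]\mapsto\mathrm{pres}(V)$ is a well-defined bijection from the equivalence classes of classical tilting right $R$-modules $V$ whose torsion pair restricts to $\mathrm{mod}\text{-}R$ onto the special preenveloping torsion classes in $\mathrm{mod}\text{-}R$. (c) Suppose moreover that $R$ is Krull--Schmidt, i.e. every finitely presented right $R$-module is a finite direct sum of modules with local endomorphism rings. Then, for a torsion class $\mathcal T$ in $\mathrm{mod}\text{-}R$, the conditions "semi-special preenveloping", "preenveloping" and "enveloping" are equivalent, and so are "special preenveloping", "cogenerating and preenveloping" and "cogenerating and enveloping". -/

import Mathlib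

open CategoryTheory CategoryTheory.Limits

universe v u

namespace TiltingTheory

/-! ### Torsion pairs, approximations and quasi-tilting objects in an abelian category

Subcategories are full, and are given as properties of objects. -/

section AbelianCategory

variable {A : Type u} [Category.{v} A] [Abelian A]

/-- `Ext¹(X, Y) = 0` (Yoneda extensions): every short exact sequence `0 ⟶ Y ⟶ E ⟶ X ⟶ 0`
splits. -/
def ExtOneVanishes (X Y : A) : Prop :=
  ∀ (E : A) (f : Y ⟶ E) (g : E ⟶ X) (w : f ≫ g = 0),
    (ShortComplex.mk f g w).ShortExact → Nonempty (ShortComplex.mk f g w).Splitting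

/-- `V^{⊥₁}`, the objects `Y` with `Ext¹(V, Y) = 0`. -/
def rightExtOrthogonal (V : A) : ObjectProperty A := fun Y => ExtOneVanishes V Y

/-- `^{⊥₁}T`, the objects `X` with `Ext¹(X, Y) = 0` for all `Y` in `T`. -/
def leftExtOrthogonal (T : ObjectProperty A) : ObjectProperty A :=
  fun X => ∀ Y, T Y → ExtOneVanishes X Y

/-- `Add(V)`: direct summands of those coproducts of copies of `V` that exist in `A`. -/
def Add (V : A) : ObjectProperty A := fun X =>
  ∃ (I : Type v) (c : Cofan fun _ : I => V),
    Nonempty (IsColimit c) ∧ Nonempty (Retract X c.pt)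

/-- `add(V)`: direct summands of finite coproducts of copies of `V`. -/
def finAdd (V : A) : ObjectProperty A := fun X =>
  ∃ (n : ℕ) (c : Cofan fun _ : Fin n => V),
    Nonempty (IsColimit c) ∧ Nonempty (Retract X c.pt)

/-- `Gen(V)`: quotients of objects of `Add(V)`. -/
def Gen (V : A) : ObjectProperty A := fun X =>
  ∃ (Y : A) (p : Y ⟶ X), Add V Y ∧ Epi p

/-- `Pres(V)`: cokernels of morphisms in `Add(V)`. -/
def Pres (V : A) : ObjectProperty A := fun X =>
  ∃ (Y Z : A) (f : Y ⟶ Z), Add V Y ∧ Add V Z ∧ Nonempty (cokernel f ≅ X)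

/-- `pres(V)`: cokernels of morphisms in `add(V)`. -/
def finPres (V : A) : ObjectProperty A := fun X =>
  ∃ (Y Z : A) (f : Y ⟶ Z), finAdd V Y ∧ finAdd V Z ∧ Nonempty (cokernel f ≅ X)

/-- `Sub(T)`: objects that embed in some object of `T`. -/
def Sub (T : ObjectProperty A) : ObjectProperty A := fun X =>
  ∃ (Y : A) (i : X ⟶ Y), T Y ∧ Mono i

/-- `T` is cogenerating: every object embeds in an object of `T`. -/
def IsCogenerating (T : ObjectProperty A) : Prop := ∀ X, Sub T X

/-- Torsion pairs in an abelian category. -/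
structure IsTorsionPair (T F : ObjectProperty A) : Prop where
  right_eq : T.rightOrthogonal = F
  left_eq : F.leftOrthogonal = T
  exists_shortExact : ∀ X : A, ∃ (X' X'' : A) (i : X' ⟶ X) (p : X ⟶ X'') (w : i ≫ p = 0),
    T X' ∧ F X'' ∧ (ShortComplex.mk i p w).ShortExact

/-- Torsion classes. -/
def IsTorsionClass (T : ObjectProperty A) : Prop := ∃ F, IsTorsionPair T F

/-- `V^⊥`, the objects `Y` with `Hom(V, Y) = 0`. -/
def homOrthogonal (V : A) : ObjectProperty A := fun Y => ∀ f : V ⟶ Y, f = 0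

/-- Quasi-tilting objects: there is a torsion pair whose torsion class `T` satisfies
`T = Gen(V) = Pres(V) = Sub(Gen(V)) ∩ V^{⊥₁}`. -/
def IsQuasiTilting (V : A) : Prop :=
  ∃ T F : ObjectProperty A, IsTorsionPair T F ∧
    T = Gen V ∧ T = Pres V ∧ T = Sub (Gen V) ⊓ rightExtOrthogonal V

/-- `φ : M ⟶ X` is a `T`-preenvelope. -/
structure IsPreenvelope (T : ObjectProperty A) {M X : A} (φ : M ⟶ X) : Prop where
  mem : T X
  exists_factor : ∀ (Y : A), T Y → ∀ g : M ⟶ Y, ∃ h : X ⟶ Y, φ ≫ h = g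

/-- Semi-special `T`-preenvelopes. -/
structure IsSemiSpecialPreenvelope (T : ObjectProperty A) {M X : A} (φ : M ⟶ X) : Prop
    extends IsPreenvelope T φ where
  cokernel_mem : leftExtOrthogonal T (cokernel φ)

/-- Special `T`-preenvelopes. -/
structure IsSpecialPreenvelope (T : ObjectProperty A) {M X : A} (φ : M ⟶ X) : Prop
    extends IsSemiSpecialPreenvelope T φ where
  mono : Mono φ

/-- `T`-envelopes: left minimal `T`-preenvelopes. -/
structure IsEnvelope (T : ObjectProperty A) {M X : A} (φ : M ⟶ X) : Prop
    extends IsPreenvelope T φ where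
  left_minimal : ∀ ψ : X ⟶ X, φ ≫ ψ = φ → IsIso ψ

/-- Every object has a `T`-preenvelope. -/
def IsPreenveloping (T : ObjectProperty A) : Prop :=
  ∀ M : A, ∃ (X : A) (φ : M ⟶ X), IsPreenvelope T φ

/-- Every object has a semi-special `T`-preenvelope. -/
def IsSemiSpecialPreenveloping (T : ObjectProperty A) : Prop :=
  ∀ M : A, ∃ (X : A) (φ : M ⟶ X), IsSemiSpecialPreenvelope T φ

/-- Every object has a special `T`-preenvelope. -/
def IsSpecialPreenveloping (T : ObjectProperty A) : Prop :=
  ∀ M : A, ∃ (X : A) (φ : M ⟶ X), IsSpecialPreenvelope T φ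

/-- Every object has a `T`-envelope. -/
def IsEnveloping (T : ObjectProperty A) : Prop :=
  ∀ M : A, ∃ (X : A) (φ : M ⟶ X), IsEnvelope T φ

variable (A) in
/-- Krull-Schmidt abelian categories: every object is a finite coproduct of objects with local
endomorphism rings. -/
def IsKrullSchmidt : Prop :=
  ∀ X : A, ∃ (n : ℕ) (Y : Fin n → A), (∀ i, IsLocalRing (End (Y i))) ∧ Nonempty ((∐ Y) ≅ X)

end AbelianCategory

/-! ### Right modules over a ring `R`, i.e. modules over `Rᵐᵒᵖ` -/

/-- Right coherent rings: finitely generated right ideals are finitely presented. -/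
class IsRightCoherent (R : Type u) [Ring R] : Prop where
  finitePresentation_of_fg : ∀ I : Submodule Rᵐᵒᵖ R, I.FG → Module.FinitePresentation Rᵐᵒᵖ I

/-- `Mod-R`, the category of right `R`-modules. -/
abbrev RMod (R : Type u) [Ring R] := ModuleCat.{u} Rᵐᵒᵖ

/-- The finitely presented right `R`-modules. -/
def isFP (R : Type u) [Ring R] : ObjectProperty (RMod R) :=
  fun M => Module.FinitePresentation Rᵐᵒᵖ M

/-- `mod-R`, the full subcategory of finitely presented right `R`-modules. -/
abbrev FPMod (R : Type u) [Ring R] := (isFP R).FullSubcategory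

section Coherent

variable {S : Type*} [Ring S]

theorem fp_of_fg_pi (hS : ∀ I : Submodule S S, I.FG → Module.FinitePresentation S I) (n : ℕ) :
    ∀ N : Submodule S (Fin n → S), N.FG → Module.FinitePresentation S N := by
  induction n with
  | zero => intro N _; infer_instance
  | succ n ih =>
    intro N hN
    have : Module.Finite S N := Module.Finite.iff_fg.2 hN
    let π : N →ₗ[S] S := (LinearMap.proj 0).comp N.subtype
    have hI : (LinearMap.range π).FG := by
      rw [LinearMap.range_eq_map]
      exact (Module.finite_def.1 ‹_›).map π
    have hfpI := hS _ hI
    let π' : N →ₗ[S] LinearMap.range π := π.rangeRestrict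
    have hπ' : Function.Surjective π' := π.surjective_rangeRestrict
    have hker : (LinearMap.ker π').FG := Module.FinitePresentation.fg_ker π' hπ'
    let q : LinearMap.ker π' →ₗ[S] (Fin n → S) :=
      (LinearMap.funLeft S S Fin.succ).comp (N.subtype.comp (LinearMap.ker π').subtype)
    have hq : Function.Injective q := by
      intro x y hxy
      have hx : (x : N).1 0 = 0 := congrArg Subtype.val (LinearMap.mem_ker.1 x.2)
      have hy : (y : N).1 0 = 0 := congrArg Subtype.val (LinearMap.mem_ker.1 y.2)
      apply Subtype.ext
      apply Subtype.ext
      funext i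
      exact Fin.cases (hx.trans hy.symm) (fun j => congrFun hxy j) i
    have : Module.Finite S (LinearMap.ker π') := Module.Finite.iff_fg.2 hker
    have hfpk : Module.FinitePresentation S (LinearMap.range q) := by
      refine ih _ ?_
      rw [LinearMap.range_eq_map]
      exact (Module.finite_def.1 ‹_›).map q
    have : Module.FinitePresentation S (LinearMap.ker π') :=
      Module.FinitePresentation.of_equiv (R := S) (M := LinearMap.range q)
        (N := LinearMap.ker π') (LinearEquiv.ofInjective q hq).symm
    exact Module.finitePresentation_of_ker π' hπ'

theorem fp_of_fg_submodule (hS : ∀ I : Submodule S S, I.FG → Module.FinitePresentation S I)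
    {M : Type*} [AddCommGroup M] [Module S M] [Module.FinitePresentation S M]
    (N : Submodule S M) (hN : N.FG) : Module.FinitePresentation S N := by
  obtain ⟨n, π, hπ⟩ := Module.Finite.exists_fin' S M
  have hK : (LinearMap.ker π).FG := Module.FinitePresentation.fg_ker π hπ
  have hfg : (N.comap π).FG := by
    apply Submodule.fg_of_fg_map_of_fg_inf_ker π
    · rwa [Submodule.map_comap_eq_of_surjective hπ]
    · rwa [inf_eq_right.2 (LinearMap.ker_le_comap π)]
  have := fp_of_fg_pi hS n _ hfg
  let g : N.comap π →ₗ[S] N := π.restrict fun _ h => h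
  have hg : Function.Surjective g := by
    rintro ⟨y, hy⟩
    obtain ⟨x, rfl⟩ := hπ y
    exact ⟨⟨x, hy⟩, rfl⟩
  refine Module.finitePresentation_of_surjective g hg ?_
  have hmap : (LinearMap.ker g).map (N.comap π).subtype = LinearMap.ker π := by
    ext x
    constructor
    · rintro ⟨y, hy, rfl⟩
      exact congrArg Subtype.val (LinearMap.mem_ker.1 hy)
    · intro hx
      exact ⟨⟨x, LinearMap.ker_le_comap π hx⟩, Subtype.ext hx, rfl⟩
  exact Submodule.fg_of_fg_map_injective _ (Submodule.injective_subtype _) (hmap ▸ hK)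

theorem IsRightCoherent.fp_of_fg_left {R : Type u} [Ring R] [IsRightCoherent R]
    (I : Submodule Rᵐᵒᵖ Rᵐᵒᵖ) (hI : I.FG) : Module.FinitePresentation Rᵐᵒᵖ I := by
  let e : R ≃ₗ[Rᵐᵒᵖ] Rᵐᵒᵖ := { MulOpposite.opAddEquiv with map_smul' := fun _ _ => rfl }
  have := IsRightCoherent.finitePresentation_of_fg _ (hI.map e.symm.toLinearMap)
  exact Module.FinitePresentation.of_equiv (e.symm.submoduleMap I).symm

end Coherent

/-! By the following instances `mod-R` is closed under finite products, kernels and cokernels in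
`Mod-R` when `R` is right coherent, so that it is an abelian category. -/

section FPModAbelian

variable (R : Type u) [Ring R]

instance : (isFP R).IsClosedUnderIsomorphisms where
  of_iso e h := by
    have : Module.FinitePresentation _ _ := h
    exact Module.FinitePresentation.of_equiv e.toLinearEquiv

instance : (isFP R).ContainsZero where
  exists_zero := ⟨ModuleCat.of _ PUnit, ModuleCat.isZero_of_subsingleton _,
    Module.FinitePresentation.of_subsingleton _⟩

instance : (isFP R).IsClosedUnderBinaryProducts where
  limitsOfShape_le := by
    rintro X ⟨p⟩
    have h₁ : Module.FinitePresentation Rᵐᵒᵖ (p.diag.obj ⟨WalkingPair.left⟩) :=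
      p.prop_diag_obj _
    have h₂ : Module.FinitePresentation Rᵐᵒᵖ (p.diag.obj ⟨WalkingPair.right⟩) :=
      p.prop_diag_obj _
    exact (isFP R).prop_of_iso
      (p.isLimit.conePointsIsoOfNatIso (ModuleCat.binaryProductLimitCone _ _).isLimit
        (diagramIsoPair p.diag)).symm
      (Module.FinitePresentation.prod _ _)

instance : (isFP R).IsClosedUnderFiniteProducts :=
  ObjectProperty.IsClosedUnderFiniteProducts.mk'

instance : (isFP R).IsClosedUnderCokernels where
  cokernels_le := by
    rintro _ ⟨f, k, hk, hX, hY⟩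
    have hX : Module.FinitePresentation _ _ := hX
    have hY : Module.FinitePresentation _ _ := hY
    refine (isFP R).prop_of_iso
      ((ModuleCat.cokernelIsColimit f).coconePointUniqueUpToIso hk) ?_
    have hr : (LinearMap.ker (LinearMap.range f.hom).mkQ).FG := by
      rw [Submodule.ker_mkQ, LinearMap.range_eq_map]
      exact (Module.finite_def.1 inferInstance).map f.hom
    exact Module.finitePresentation_of_surjective (LinearMap.range f.hom).mkQ
      (Submodule.mkQ_surjective _) hr

instance [IsRightCoherent R] : (isFP R).IsClosedUnderKernels where
  kernels_le := by
    rintro _ ⟨f, k, hk, hX, hY⟩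
    have hX : Module.FinitePresentation _ _ := hX
    have hY : Module.FinitePresentation _ _ := hY
    refine (isFP R).prop_of_iso ((ModuleCat.kernelIsLimit f).conePointUniqueUpToIso hk) ?_
    have hr : (LinearMap.range f.hom).FG := by
      rw [LinearMap.range_eq_map]
      exact (Module.finite_def.1 inferInstance).map f.hom
    have := fp_of_fg_submodule IsRightCoherent.fp_of_fg_left _ hr
    have hker : (LinearMap.ker f.hom).FG := by
      rw [← LinearMap.ker_rangeRestrict]
      exact Module.FinitePresentation.fg_ker _ f.hom.surjective_rangeRestrict
    exact fp_of_fg_submodule IsRightCoherent.fp_of_fg_left _ hker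

end FPModAbelian

section Modules

variable {R : Type u} [Ring R]

/-- A right module `V` is finendo if it is finitely generated over its endomorphism ring. -/
def IsFinendo (V : RMod R) : Prop := Module.Finite (Module.End Rᵐᵒᵖ V) V

/-- Classical tilting modules:
(1) there is a short exact sequence `0 ⟶ P₁ ⟶ P₀ ⟶ V ⟶ 0` with `P₀`, `P₁` finitely generated
projective; (2) `Ext¹(V, V) = 0`; (3) there is a short exact sequence `0 ⟶ R ⟶ V₀ ⟶ V₁ ⟶ 0`
with `V₀`, `V₁` in `add(V)`. -/
structure IsClassicalTilting (V : RMod R) : Prop where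
  exists_resolution : ∃ (P₁ P₀ : RMod R) (f : P₁ ⟶ P₀) (g : P₀ ⟶ V) (w : f ≫ g = 0),
    (Module.Finite Rᵐᵒᵖ P₁ ∧ Module.Projective Rᵐᵒᵖ P₁) ∧
    (Module.Finite Rᵐᵒᵖ P₀ ∧ Module.Projective Rᵐᵒᵖ P₀) ∧
    (ShortComplex.mk f g w).ShortExact
  ext_self : ExtOneVanishes V V
  exists_coresolution : ∃ (V₀ V₁ : RMod R) (f : ModuleCat.of Rᵐᵒᵖ R ⟶ V₀) (g : V₀ ⟶ V₁)
    (w : f ≫ g = 0), finAdd V V₀ ∧ finAdd V V₁ ∧ (ShortComplex.mk f g w).ShortExact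

/-- The class of modules `T`, intersected with `mod-R`. -/
abbrev toFP (T : ObjectProperty (RMod R)) : ObjectProperty (FPMod R) :=
  T.inverseImage (isFP R).ι

/-- The pair `(Gen(V), V^⊥)` in `Mod-R` restricts to a torsion pair in `mod-R`. -/
def TorsionPairRestricts [IsRightCoherent R] (V : RMod R) : Prop :=
  IsTorsionPair (toFP (Gen V)) (toFP (homOrthogonal V))

variable (R) in
/-- The finitely presented finendo quasi-tilting modules whose torsion pair restricts. -/
def QuasiTiltingModules [IsRightCoherent R] : ObjectProperty (RMod R) :=
  fun V => isFP R V ∧ IsFinendo V ∧ IsQuasiTilting V ∧ TorsionPairRestricts V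

variable (R) in
/-- The classical tilting modules whose torsion pair restricts. -/
def ClassicalTiltingModules [IsRightCoherent R] : ObjectProperty (RMod R) :=
  fun V => IsClassicalTilting V ∧ TorsionPairRestricts V

/-- Two modules `V`, `V'` in a given class are equivalent if `Add(V) = Add(V')` in `Mod-R`. -/
def addSetoid (P : ObjectProperty (RMod R)) : Setoid {V : RMod R // P V} where
  r V W := Add V.1 = Add W.1
  iseqv := ⟨fun _ => rfl, fun h => h.symm, fun h h' => h.trans h'⟩

/-- The equivalence classes of modules in a given class. -/
def EquivClasses (P : ObjectProperty (RMod R)) := Quotient (addSetoid P)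

/-- The equivalence class `[V]`. -/
def EquivClasses.mk {P : ObjectProperty (RMod R)} (V : RMod R) (hV : P V) : EquivClasses P :=
  Quotient.mk (addSetoid P) ⟨V, hV⟩

variable (R) in
/-- The semi-special preenveloping torsion classes in `mod-R`. -/
def SemiSpecialTorsionClasses [IsRightCoherent R] : Set (ObjectProperty (FPMod R)) :=
  {T | IsTorsionClass T ∧ IsSemiSpecialPreenveloping T}

variable (R) in
/-- The special preenveloping torsion classes in `mod-R`. -/
def SpecialTorsionClasses [IsRightCoherent R] : Set (ObjectProperty (FPMod R)) :=
  {T | IsTorsionClass T ∧ IsSpecialPreenveloping T}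

end Modules

end TiltingTheory

open TiltingTheory

/-! Write S for `Rᵐᵒᵖ`. Both assignments are studied through Gen(V) ∩ mod-R, which visibly depends
only on Add(V). The quasi-tilting condition is split into two inclusions: Gen(V) ⊆ V^{⊥₁}
(`IsGenProjective`) and Sub(Gen V) ∩ V^{⊥₁} ⊆ Gen(V) (`IsSubClosed`). Together they put the kernel
of the universal map V^(Hom(V,X)) → X in Gen(V). This has two uses: V and V' that generate each
other split off coproducts of each other (injectivity), and, after a finiteness reduction, a
finitely presented X in Gen(V) is a cokernel in add(V), so pres(V) = Gen(V) ∩ mod-R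
(`IsGenProjective.exists_presentation`).

The link to approximations is a generic element x₀ of a module V₀ in add(V): S → V₀, 1 ↦ x₀, is a
Gen(V)-preenvelope. For finendo V the tuple of generators over End(V) is one; for classical tilting
V it comes from the coresolution of R. Pushing out powers of this map along S^n → M gives
semi-special preenvelopes of every finitely presented M, and special ones if x₀ has zero
annihilator.

Conversely, a semi-special preenvelope φ : S → T₀ in a torsion class T yields V = T₀ ⊕ Coker φ. Its
Ext against T vanishes by a Wakamatsu-type argument. This spreads to all of Gen(V), because syzygies
are finitely presented by coherence and their maps into Gen(V) factor through T. If T is special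
preenveloping, the syzygy of V is moreover projective, so V is classical tilting.

For (c), a preenvelope with the least number of local summands is left minimal by a Jacobson radical
argument, and Wakamatsu's lemma makes envelopes semi-special. A cogenerating class has only
injective preenvelopes. -/

namespace TiltingTheory

/-! ### Vanishing of Ext¹ as lifting and extension of linear maps -/

section Linear

variable {S : Type u} [Ring S]

/-- `Ext¹(X, Y) = 0` for unbundled modules. -/
def ExtVanish (S : Type u) [Ring S] (X Y : Type u) [AddCommGroup X] [Module S X]
    [AddCommGroup Y] [Module S Y] : Prop :=
  ∀ (E : Type u) [AddCommGroup E] [Module S E] (f : Y →ₗ[S] E) (g : E →ₗ[S] X),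
    Function.Injective f → Function.Exact f g → Function.Surjective g →
      ∃ s : X →ₗ[S] E, g ∘ₗ s = LinearMap.id

variable {X Y E B P V W M G : Type u} [AddCommGroup X] [Module S X] [AddCommGroup Y] [Module S Y]
  [AddCommGroup E] [Module S E] [AddCommGroup B] [Module S B] [AddCommGroup P] [Module S P]
  [AddCommGroup V] [Module S V] [AddCommGroup W] [Module S W] [AddCommGroup M] [Module S M]
  [AddCommGroup G] [Module S G]

theorem ExtVanish.lift (h : ExtVanish S X Y) (i : Y →ₗ[S] E) (p : E →ₗ[S] B)
    (hi : Function.Injective i) (hip : Function.Exact i p) (hp : Function.Surjective p)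
    (φ : X →ₗ[S] B) : ∃ ψ : X →ₗ[S] E, p ∘ₗ ψ = φ := by
  -- Pull the extension back along φ; a section of the pullback over X, followed by projection to E,
  -- is the lift.
  let Q : Submodule S (E × X) :=
    LinearMap.eqLocus (p ∘ₗ LinearMap.fst S E X) (φ ∘ₗ LinearMap.snd S E X)
  have hQ (x : Q) : p x.1.1 = φ x.1.2 := x.2
  let j : Y →ₗ[S] Q := (LinearMap.inl S E X ∘ₗ i).codRestrict Q fun y => by
    change p (i y) = φ 0
    rw [hip.apply_apply_eq_zero, map_zero]
  obtain ⟨s, hs⟩ := h Q j (LinearMap.snd S E X ∘ₗ Q.subtype)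
    (fun a b hab => hi (congrArg (fun x : Q => x.1.1) hab))
    (fun x => by
      constructor
      · intro hx
        have hx' : x.1.2 = 0 := hx
        obtain ⟨y, hy⟩ := (hip x.1.1).1 (by rw [hQ, hx', map_zero])
        exact ⟨y, Subtype.ext (Prod.ext hy hx'.symm)⟩
      · rintro ⟨y, rfl⟩
        rfl)
    (fun x => by
      obtain ⟨e, he⟩ := hp (φ x)
      exact ⟨⟨(e, x), he⟩, rfl⟩)
  refine ⟨LinearMap.fst S E X ∘ₗ Q.subtype ∘ₗ s, LinearMap.ext fun x => ?_⟩
  have h1 : (s x).1.2 = x := LinearMap.congr_fun hs x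
  exact (hQ (s x)).trans (by rw [h1])

theorem extVanish_of_lift (h : ∀ (E B : Type u) [AddCommGroup E] [Module S E] [AddCommGroup B]
    [Module S B] (i : Y →ₗ[S] E) (p : E →ₗ[S] B), Function.Injective i → Function.Exact i p →
      Function.Surjective p → ∀ φ : X →ₗ[S] B, ∃ ψ : X →ₗ[S] E, p ∘ₗ ψ = φ) : ExtVanish S X Y :=
  fun E _ _ f g hf hfg hg => h E X f g hf hfg hg LinearMap.id

theorem ExtVanish.lift_ker {p : E →ₗ[S] B} (h : ExtVanish S X (LinearMap.ker p))
    (hp : Function.Surjective p) (φ : X →ₗ[S] B) : ∃ ψ : X →ₗ[S] E, p ∘ₗ ψ = φ :=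
  h.lift (LinearMap.ker p).subtype p (Submodule.injective_subtype _)
    (LinearMap.exact_subtype_ker_map p) hp φ

theorem ExtVanish.lift_mkQ {K : Submodule S E} (h : ExtVanish S X K) (φ : X →ₗ[S] E ⧸ K) :
    ∃ ψ : X →ₗ[S] E, K.mkQ ∘ₗ ψ = φ :=
  h.lift K.subtype K.mkQ (Submodule.injective_subtype _) (LinearMap.exact_subtype_mkQ K)
    (Submodule.mkQ_surjective K) φ

theorem ExtVanish.of_retract (h : ExtVanish S P Y) (i : X →ₗ[S] P) (r : P →ₗ[S] X)
    (hir : r ∘ₗ i = LinearMap.id) : ExtVanish S X Y := by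
  refine extVanish_of_lift fun E B _ _ _ _ j p hj hjp hp φ => ?_
  obtain ⟨ψ, hψ⟩ := h.lift j p hj hjp hp (φ ∘ₗ r)
  exact ⟨ψ ∘ₗ i, by rw [← LinearMap.comp_assoc, hψ, LinearMap.comp_assoc, hir,
    LinearMap.comp_id]⟩

theorem ExtVanish.prod (h₁ : ExtVanish S X Y) (h₂ : ExtVanish S P Y) :
    ExtVanish S (X × P) Y := by
  refine extVanish_of_lift fun E B _ _ _ _ j p hj hjp hp φ => ?_
  obtain ⟨ψ₁, hψ₁⟩ := h₁.lift j p hj hjp hp (φ ∘ₗ LinearMap.inl S X P)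
  obtain ⟨ψ₂, hψ₂⟩ := h₂.lift j p hj hjp hp (φ ∘ₗ LinearMap.inr S X P)
  exact ⟨ψ₁.coprod ψ₂, by
    rw [LinearMap.comp_coprod, hψ₁, hψ₂, ← LinearMap.comp_coprod, LinearMap.coprod_inl_inr,
      LinearMap.comp_id]⟩

theorem ExtVanish.pi (h : ExtVanish S X Y) (ι : Type) [Finite ι] : ExtVanish S (ι → X) Y := by
  classical
  have := Fintype.ofFinite ι
  refine extVanish_of_lift fun E B _ _ _ _ j p hj hjp hp φ => ?_
  choose ψ hψ using fun i => h.lift j p hj hjp hp (φ ∘ₗ LinearMap.single S (fun _ => X) i)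
  refine ⟨LinearMap.lsum S (fun _ => X) ℕ ψ, LinearMap.pi_ext' fun i => ?_⟩
  rw [← hψ i]
  ext x
  simp [LinearMap.lsum_apply, Pi.single_apply, apply_ite]

/-- Maps on the kernel of a surjection `p : P → X` extend to `P`. -/
theorem ExtVanish.extend (h : ExtVanish S X Y) (p : P →ₗ[S] X) (hp : Function.Surjective p)
    (K : Submodule S P) (hK : K = LinearMap.ker p) (g : K →ₗ[S] Y) :
    ∃ g' : P →ₗ[S] Y, ∀ x : K, g' x = g x := by
  subst hK
  -- Push out along g: the quotient by D is an extension of X by Y, hence splits.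
  let D : Submodule S (Y × P) := LinearMap.range (g.prod (-(LinearMap.ker p).subtype))
  have hD : D ≤ LinearMap.ker (p ∘ₗ LinearMap.snd S Y P) := by
    rintro _ ⟨x, rfl⟩
    simp
  let q : ((Y × P) ⧸ D) →ₗ[S] X := D.liftQ _ hD
  let j : Y →ₗ[S] (Y × P) ⧸ D := D.mkQ ∘ₗ LinearMap.inl S Y P
  have hj : Function.Injective j := by
    rw [← LinearMap.ker_eq_bot, LinearMap.ker_eq_bot']
    intro y hy
    obtain ⟨x, hx⟩ := (Submodule.Quotient.mk_eq_zero D).1 hy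
    have h1 : g x = y := congrArg Prod.fst hx
    have h2 : -(x : P) = 0 := congrArg Prod.snd hx
    have h3 : x = 0 := Subtype.ext (neg_eq_zero.1 h2)
    rw [← h1, h3, map_zero]
  obtain ⟨s, hs⟩ := h _ j q hj
    (fun z => by
      constructor
      · intro hz
        obtain ⟨⟨y, a⟩, rfl⟩ := D.mkQ_surjective z
        have ha : p a = 0 := hz
        refine ⟨y + g ⟨a, ha⟩, (Submodule.Quotient.eq D).2 ⟨⟨a, ha⟩, ?_⟩⟩
        simp
      · rintro ⟨y, rfl⟩
        change p 0 = 0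
        exact map_zero p)
    (fun x => by
      obtain ⟨a, rfl⟩ := hp x
      exact ⟨D.mkQ (0, a), rfl⟩)
  let k : P →ₗ[S] (Y × P) ⧸ D := D.mkQ ∘ₗ LinearMap.inr S Y P
  -- The difference of the structure map and the section dies in X, so it takes values in Y; this
  -- difference is the extension of g.
  have hk (a : P) : k a - s (p a) ∈ LinearMap.range j := by
    obtain ⟨⟨y, b⟩, hb⟩ := D.mkQ_surjective (k a - s (p a))
    have hq : q (k a - s (p a)) = 0 := by
      rw [map_sub]
      have : q (s (p a)) = p a := LinearMap.congr_fun hs (p a)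
      rw [this]
      exact sub_self (p a)
    rw [← hb] at hq ⊢
    have ha : p b = 0 := hq
    exact ⟨y + g ⟨b, ha⟩, (Submodule.Quotient.eq D).2 ⟨⟨b, ha⟩, by simp⟩⟩
  let e := LinearEquiv.ofInjective j hj
  refine ⟨e.symm.toLinearMap ∘ₗ (k - s ∘ₗ p).codRestrict _ hk, fun x => ?_⟩
  change e.symm _ = _
  rw [LinearEquiv.symm_apply_eq]
  apply Subtype.ext
  change k x - s (p x) = j (g x)
  rw [show p x = 0 from x.2, map_zero, sub_zero]
  exact ((Submodule.Quotient.eq D).2 ⟨x, by simp⟩).symm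

theorem exists_descend (p : P →ₗ[S] X) (hp : Function.Surjective p) (f : P →ₗ[S] Y)
    (hf : LinearMap.ker p ≤ LinearMap.ker f) : ∃ f' : X →ₗ[S] Y, f' ∘ₗ p = f := by
  refine ⟨(LinearMap.ker p).liftQ f hf ∘ₗ (p.quotKerEquivOfSurjective hp).symm.toLinearMap, ?_⟩
  ext x
  have : (p.quotKerEquivOfSurjective hp).symm (p x) = (LinearMap.ker p).mkQ x := by
    rw [LinearEquiv.symm_apply_eq]
    rfl
  simp only [LinearMap.comp_apply, LinearEquiv.coe_coe, this]
  rfl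

/-- The cokernel of a map `a : A → B` along which all maps to `Y` extend. -/
theorem ExtVanish.of_extends (h : ExtVanish S B Y) (a : M →ₗ[S] B) (p : B →ₗ[S] X)
    (hap : Function.Exact a p) (hp : Function.Surjective p)
    (hext : ∀ f : M →ₗ[S] Y, ∃ f' : B →ₗ[S] Y, f' ∘ₗ a = f) : ExtVanish S X Y := by
  intro E _ _ i q hi hiq hq
  -- With p lifted to l, the composite l ∘ a lands in Y. Extending it to g on B makes l - i ∘ g
  -- vanish on the image of a, so it descends to a section. Injectivity of a plays no role, which
  -- matters for preenvelopes that are not monomorphisms.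
  obtain ⟨l, hl⟩ := h.lift i q hi hiq hq p
  have hl' (x : B) : q (l x) = p x := LinearMap.congr_fun hl x
  let e := LinearEquiv.ofInjective i hi
  have hmem (x : M) : (l ∘ₗ a) x ∈ LinearMap.range i :=
    (hiq _).1 ((hl' _).trans (hap.apply_apply_eq_zero x))
  obtain ⟨g, hg⟩ := hext (e.symm.toLinearMap ∘ₗ (l ∘ₗ a).codRestrict _ hmem)
  have hker : LinearMap.ker p ≤ LinearMap.ker (l - i ∘ₗ g) := by
    intro x hx
    obtain ⟨m, rfl⟩ := (hap x).1 hx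
    have h1 : e (g (a m)) = ⟨l (a m), hmem m⟩ := by
      rw [← LinearEquiv.eq_symm_apply]
      exact LinearMap.congr_fun hg m
    have h2 : i (g (a m)) = l (a m) := congrArg Subtype.val h1
    simp [h2]
  obtain ⟨t, ht⟩ := exists_descend p hp _ hker
  refine ⟨t, ?_⟩
  ext x
  obtain ⟨b, rfl⟩ := hp x
  have : t (p b) = l b - i (g b) := LinearMap.congr_fun ht b
  simp [this, hl', hiq.apply_apply_eq_zero]

theorem extVanish_of_projective [Module.Projective S X] : ExtVanish S X Y :=
  fun _ _ _ _ g _ _ hg => Module.projective_lifting_property g LinearMap.id hg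

theorem extVanish_of_extend [Module.Projective S P] (p : P →ₗ[S] X) (hp : Function.Surjective p)
    (h : ∀ g : LinearMap.ker p →ₗ[S] Y, ∃ g' : P →ₗ[S] Y, ∀ x : LinearMap.ker p, g' x = g x) :
    ExtVanish S X Y :=
  (extVanish_of_projective (X := P)).of_extends (LinearMap.ker p).subtype p
    (LinearMap.exact_subtype_ker_map p) hp
    fun f => (h f).imp fun _ hf' => LinearMap.ext hf'

end Linear

/-! ### Traces and modules generated by V -/

section Trace

variable {S : Type u} [Ring S]
variable {X Y E B P V W M G L : Type u} [AddCommGroup X] [Module S X] [AddCommGroup Y] [Module S Y]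
  [AddCommGroup E] [Module S E] [AddCommGroup B] [Module S B] [AddCommGroup P] [Module S P]
  [AddCommGroup V] [Module S V] [AddCommGroup W] [Module S W] [AddCommGroup M] [Module S M]
  [AddCommGroup G] [Module S G] [AddCommGroup L] [Module S L]

/-- The trace of `V` in `X`: the sum of the images of all maps `V → X`. -/
def trace (S : Type u) [Ring S] (V X : Type u) [AddCommGroup V] [Module S V] [AddCommGroup X]
    [Module S X] : Submodule S X :=
  ⨆ f : V →ₗ[S] X, LinearMap.range f

/-- `X` is generated by `V`: it is the sum of the images of the maps `V → X`. -/
def IsGenBy (S : Type u) [Ring S] (V X : Type u) [AddCommGroup V] [Module S V] [AddCommGroup X]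
    [Module S X] : Prop :=
  trace S V X = ⊤

theorem apply_mem_trace (f : V →ₗ[S] X) (v : V) : f v ∈ trace S V X :=
  Submodule.mem_iSup_of_mem f ⟨v, rfl⟩

theorem trace_le_iff {N : Submodule S X} :
    trace S V X ≤ N ↔ ∀ (f : V →ₗ[S] X) (v : V), f v ∈ N := by
  rw [trace, iSup_le_iff]
  exact forall_congr' fun f => ⟨fun h v => h ⟨v, rfl⟩, by rintro h _ ⟨v, rfl⟩; exact h v⟩

theorem map_trace_le (f : X →ₗ[S] Y) : (trace S V X).map f ≤ trace S V Y := by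
  rw [Submodule.map_le_iff_le_comap, trace_le_iff]
  exact fun g v => apply_mem_trace (f ∘ₗ g) v

theorem map_mem_trace (f : X →ₗ[S] Y) {x : X} (hx : x ∈ trace S V X) : f x ∈ trace S V Y :=
  map_trace_le f ⟨x, hx, rfl⟩

theorem isGenBy_self : IsGenBy S V V :=
  top_unique fun v _ => apply_mem_trace LinearMap.id v

theorem IsGenBy.of_surjective (h : IsGenBy S V X) (f : X →ₗ[S] Y) (hf : Function.Surjective f) :
    IsGenBy S V Y := by
  refine top_unique fun y _ => ?_
  obtain ⟨x, rfl⟩ := hf y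
  exact map_mem_trace f (h.symm ▸ Submodule.mem_top)

theorem IsGenBy.range (h : IsGenBy S V X) (f : X →ₗ[S] Y) : IsGenBy S V (LinearMap.range f) :=
  h.of_surjective f.rangeRestrict f.surjective_rangeRestrict

theorem isGenBy_of_forall (h : ∀ x : X, x ∈ trace S V X) : IsGenBy S V X :=
  top_unique fun x _ => h x

theorem IsGenBy.mem (h : IsGenBy S V X) (x : X) : x ∈ trace S V X := h.symm ▸ Submodule.mem_top

theorem IsGenBy.le_trace (h : IsGenBy S V X) (f : X →ₗ[S] Y) :
    LinearMap.range f ≤ trace S V Y := by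
  rintro _ ⟨x, rfl⟩
  exact map_mem_trace f (h.mem x)

theorem IsGenBy.trans (h : IsGenBy S V W) (h' : IsGenBy S W X) : IsGenBy S V X := by
  refine top_unique (h'.symm.le.trans ?_)
  rw [trace_le_iff]
  exact fun f w => h.le_trace f ⟨w, rfl⟩

theorem isGenBy_trace : IsGenBy S V (trace S V X) := by
  have h : trace S V X ≤ (trace S V (trace S V X)).map (trace S V X).subtype := by
    rw [trace_le_iff]
    exact fun f v => ⟨⟨f v, apply_mem_trace f v⟩,
      apply_mem_trace (f.codRestrict (trace S V X) (apply_mem_trace f)) v, rfl⟩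
  refine isGenBy_of_forall fun x => ?_
  obtain ⟨y, hy, hyx⟩ := h x.2
  rwa [← Subtype.ext hyx]

theorem isGenBy_finsupp (I : Type u) : IsGenBy S V (I →₀ V) := by
  refine isGenBy_of_forall fun x => ?_
  induction x using Finsupp.induction_linear with
  | zero => exact zero_mem _
  | add f g hf hg => exact add_mem hf hg
  | single i v => exact apply_mem_trace (Finsupp.lsingle i) v

theorem isGenBy_pi (ι : Type) [Finite ι] : IsGenBy S V (ι → V) := by
  classical
  have := Fintype.ofFinite ι
  refine isGenBy_of_forall fun x => ?_
  rw [← Finset.univ_sum_single x]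
  exact sum_mem fun i _ => apply_mem_trace (LinearMap.single S (fun _ => V) i) (x i)

/-- The universal map from a coproduct of copies of `V`. -/
noncomputable def evalMap (S : Type u) [Ring S] (V X : Type u) [AddCommGroup V] [Module S V]
    [AddCommGroup X] [Module S X] : ((V →ₗ[S] X) →₀ V) →ₗ[S] X :=
  Finsupp.lsum ℕ fun f => f

theorem range_evalMap : LinearMap.range (evalMap S V X) = trace S V X := by
  apply le_antisymm
  · exact (isGenBy_finsupp _).le_trace _
  · rw [trace_le_iff]
    exact fun f v => ⟨Finsupp.single f v, by simp [evalMap]⟩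

theorem IsGenBy.evalMap_surjective (h : IsGenBy S V X) : Function.Surjective (evalMap S V X) := by
  rw [← LinearMap.range_eq_top, range_evalMap]
  exact h

/-- An element of the trace is a finite sum of values of maps from V, and submodules covered by
finite powers of V are closed under binary sums. -/
theorem exists_range_ge_of_fg (N : Submodule S X) (hN : N.FG) (h : N ≤ trace S V X) :
    ∃ (ι : Type) (_ : Finite ι) (g : (ι → V) →ₗ[S] X), N ≤ LinearMap.range g := by
  classical
  let D : Set (Submodule S X) :=
    {N | ∃ (ι : Type) (_ : Finite ι) (g : (ι → V) →ₗ[S] X), N ≤ LinearMap.range g}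
  have hsup (N₁ N₂ : Submodule S X) (h₁ : N₁ ∈ D) (h₂ : N₂ ∈ D) : N₁ ⊔ N₂ ∈ D := by
    obtain ⟨ι₁, _, g₁, h₁⟩ := h₁
    obtain ⟨ι₂, _, g₂, h₂⟩ := h₂
    refine ⟨ι₁ ⊕ ι₂, inferInstance, g₁.coprod g₂ ∘ₗ
      (LinearEquiv.sumArrowLequivProdArrow ι₁ ι₂ S V).toLinearMap, ?_⟩
    rw [LinearMap.range_comp_of_range_eq_top _ (LinearEquiv.range _), LinearMap.range_coprod]
    exact sup_le_sup h₁ h₂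
  obtain ⟨s, rfl⟩ := hN
  rw [Submodule.span_le] at h
  induction s using Finset.induction_on with
  | empty => exact ⟨PEmpty, inferInstance, 0, by simp⟩
  | insert x s hx ih =>
    rw [Finset.coe_insert] at h ⊢
    rw [Submodule.span_insert]
    refine hsup _ _ ?_ (ih fun y hy => h (Or.inr hy))
    have hx : x ∈ trace S V X := h (Or.inl rfl)
    change S ∙ x ∈ D
    refine Submodule.iSup_induction' (motive := fun x _ => S ∙ x ∈ D) _ (fun f y hy => ?_) ?_
      (fun y z _ _ hy hz => ?_) hx
    · obtain ⟨v, rfl⟩ := hy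
      refine ⟨Unit, inferInstance, f ∘ₗ LinearMap.proj (), ?_⟩
      rw [Submodule.span_singleton_le_iff_mem]
      exact ⟨fun _ => v, rfl⟩
    · exact ⟨PEmpty, inferInstance, 0, by simp⟩
    · obtain ⟨ι, hι, g, hg⟩ := hsup _ _ hy hz
      refine ⟨ι, hι, g, le_trans ?_ hg⟩
      rw [Submodule.span_singleton_le_iff_mem]
      exact add_mem (Submodule.mem_sup_left (Submodule.mem_span_singleton_self y))
        (Submodule.mem_sup_right (Submodule.mem_span_singleton_self z))

theorem IsGenBy.exists_surjective_pi [Module.Finite S X] (h : IsGenBy S V X) :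
    ∃ (ι : Type) (_ : Finite ι) (g : (ι → V) →ₗ[S] X), Function.Surjective g := by
  obtain ⟨ι, hι, g, hg⟩ := exists_range_ge_of_fg (V := V) ⊤ (Module.finite_def.1 ‹_›) h.symm.le
  exact ⟨ι, hι, g, LinearMap.range_eq_top.1 (top_unique hg)⟩

theorem IsGenBy.exists_eq_apply (h : IsGenBy S V X) (x : X) :
    ∃ (ι : Type) (_ : Finite ι) (g : (ι → V) →ₗ[S] X) (y : ι → V), g y = x := by
  obtain ⟨ι, hι, g, hg⟩ := exists_range_ge_of_fg (V := V) (S ∙ x)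
    (Submodule.fg_span_singleton x) (h.symm ▸ le_top)
  exact ⟨ι, hι, g, hg (Submodule.mem_span_singleton_self x)⟩

/-- Maps from finitely presented modules to modules generated by `V` factor through finitely
presented modules generated by `V`. -/
theorem IsGenBy.exists_factor [Module.FinitePresentation S L] [Module.FinitePresentation S V]
    (h : IsGenBy S V G) (f : L →ₗ[S] G) :
    ∃ (T : Type u) (_ : AddCommGroup T) (_ : Module S T), Module.FinitePresentation S T ∧
      IsGenBy S V T ∧ ∃ (a : L →ₗ[S] T) (b : T →ₗ[S] G), b ∘ₗ a = f := by
  obtain ⟨n, q, hq⟩ := Module.Finite.exists_fin' S L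
  have hK : (LinearMap.ker q).FG := Module.FinitePresentation.fg_ker q hq
  obtain ⟨ι, _, g, hg⟩ := exists_range_ge_of_fg (V := V) (LinearMap.range (f ∘ₗ q))
    (by rw [LinearMap.range_eq_map]; exact (Module.finite_def.1 inferInstance).map _)
    (h.symm ▸ le_top)
  -- Lift generators of L to a finite power of V. Dividing by the images of the finitely many
  -- relations of L makes the lift well defined on L and keeps the quotient finitely presented.
  obtain ⟨s, hs⟩ := Module.projective_lifting_property g.rangeRestrict
    ((f ∘ₗ q).codRestrict (LinearMap.range g) fun x => hg ⟨x, rfl⟩) g.surjective_rangeRestrict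
  have hs' (x : Fin n → S) : g (s x) = f (q x) := congrArg Subtype.val (LinearMap.congr_fun hs x)
  let K := (LinearMap.ker q).map s
  obtain ⟨a, ha⟩ := exists_descend q hq (K.mkQ ∘ₗ s) fun x hx =>
    (Submodule.Quotient.mk_eq_zero K).2 ⟨x, hx, rfl⟩
  refine ⟨(ι → V) ⧸ K, inferInstance, inferInstance,
    Module.finitePresentation_of_surjective K.mkQ K.mkQ_surjective
      (by rw [Submodule.ker_mkQ]; exact hK.map s),
    (isGenBy_pi ι).of_surjective K.mkQ K.mkQ_surjective, a, K.liftQ g ?_, ?_⟩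
  · rintro _ ⟨x, hx, rfl⟩
    rw [LinearMap.mem_ker, hs', LinearMap.mem_ker.1 hx, map_zero]
  · ext y
    obtain ⟨x, rfl⟩ := hq y
    have : a (q x) = K.mkQ (s x) := LinearMap.congr_fun ha x
    simp [this, hs']

end Trace

/-! ### Ext-projective generators, presentations and generic elements -/

section QuasiTilting

variable {S : Type u} [Ring S]
variable {X Y P V V' V₀ V₁ M G : Type u} [AddCommGroup X] [Module S X]
  [AddCommGroup Y] [Module S Y] [AddCommGroup P] [Module S P]
  [AddCommGroup V] [Module S V] [AddCommGroup V'] [Module S V'] [AddCommGroup M] [Module S M]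
  [AddCommGroup G] [Module S G] [AddCommGroup V₀] [Module S V₀] [AddCommGroup V₁] [Module S V₁]

/-- `Gen(V) ⊆ V^{⊥₁}`. -/
def IsGenProjective (S : Type u) [Ring S] (V : Type u) [AddCommGroup V] [Module S V] : Prop :=
  ∀ (Z : Type u) [AddCommGroup Z] [Module S Z], IsGenBy S V Z → ExtVanish S V Z

/-- `Sub(Gen(V)) ∩ V^{⊥₁} ⊆ Gen(V)`. -/
def IsSubClosed (S : Type u) [Ring S] (V : Type u) [AddCommGroup V] [Module S V] : Prop :=
  ∀ (X G : Type u) [AddCommGroup X] [Module S X] [AddCommGroup G] [Module S G] (i : X →ₗ[S] G),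
    Function.Injective i → IsGenBy S V G → ExtVanish S V X → IsGenBy S V X

/-- The maps `S → Z` to modules generated by `V` factor through the map `S → V₀`, `1 ↦ x₀`. -/
def IsGeneric (S : Type u) [Ring S] (V : Type u) [AddCommGroup V] [Module S V] {V₀ : Type u}
    [AddCommGroup V₀] [Module S V₀] (x₀ : V₀) : Prop :=
  ∀ (Z : Type u) [AddCommGroup Z] [Module S Z], IsGenBy S V Z →
    ∀ z : Z, ∃ h : V₀ →ₗ[S] Z, h x₀ = z

/-- Since Ext¹(V, trace) = 0 the map lifts to X, where its values lie in the trace. This makes (Gen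
V, V^⊥) a torsion pair. -/
theorem IsGenProjective.eq_zero_of_quotient_trace (hV : IsGenProjective S V)
    (f : V →ₗ[S] X ⧸ trace S V X) : f = 0 := by
  obtain ⟨g, rfl⟩ := (hV _ isGenBy_trace).lift_mkQ f
  ext v
  exact (Submodule.Quotient.mk_eq_zero _).2 (apply_mem_trace g v)

/-- For x in X, genericity in the larger module G shows that s • x₀ ↦ s • x is well defined. Since
V₁ is the cokernel of this cyclic submodule, Ext¹(V₁, X) = 0 extends the map to V₀ → X, so x lies in
the image of a module generated by V. -/
theorem IsGeneric.isGenBy_of_injective {x₀ : V₀} (hx₀ : IsGeneric S V x₀) (hV₀ : IsGenBy S V V₀)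
    (p : V₀ →ₗ[S] V₁) (hp : Function.Surjective p) (hker : S ∙ x₀ = LinearMap.ker p)
    (i : X →ₗ[S] G) (hi : Function.Injective i) (hG : IsGenBy S V G) (hX : ExtVanish S V₁ X) :
    IsGenBy S V X := by
  refine isGenBy_of_forall fun x => ?_
  obtain ⟨h, hh⟩ := hx₀ G hG (i x)
  have hmem (y : S ∙ x₀) : (h ∘ₗ (S ∙ x₀).subtype) y ∈ LinearMap.range i := by
    obtain ⟨s, hs⟩ := Submodule.mem_span_singleton.1 y.2
    refine ⟨s • x, ?_⟩
    change _ = h y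
    rw [← hs, map_smul, map_smul, hh]
  obtain ⟨g, hg⟩ := hX.extend p hp _ hker
    ((LinearEquiv.ofInjective i hi).symm.toLinearMap ∘ₗ LinearMap.codRestrict _ _ hmem)
  have h1 : g x₀ = x := by
    rw [hg ⟨x₀, Submodule.mem_span_singleton_self x₀⟩]
    change (LinearEquiv.ofInjective i hi).symm _ = x
    rw [LinearEquiv.symm_apply_eq]
    exact Subtype.ext hh
  rw [← h1]
  exact map_mem_trace g (hV₀.mem x₀)

/-- This is the exactness of Hom(V,P) → Hom(V,X) → Ext¹(V, ker p) → Ext¹(V,P), made explicit with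
the free module on the elements of V; p need not be surjective, as only maps from V have to lift. -/
theorem ExtVanish.ker_of_lift (h : ExtVanish S V P) (p : P →ₗ[S] X)
    (hp : ∀ f : V →ₗ[S] X, ∃ f' : V →ₗ[S] P, p ∘ₗ f' = f) :
    ExtVanish S V (LinearMap.ker p) := by
  have hq : Function.Surjective (Finsupp.linearCombination S (id : V → V)) :=
    Finsupp.linearCombination_id_surjective S V
  refine extVanish_of_extend _ hq fun g => ?_
  obtain ⟨g', hg'⟩ := h.extend _ hq _ rfl ((LinearMap.ker p).subtype ∘ₗ g)
  obtain ⟨f, hf⟩ := exists_descend _ hq (p ∘ₗ g') fun x hx => by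
    change p (g' x) = 0
    rw [hg' ⟨x, hx⟩]
    exact (g ⟨x, hx⟩).2
  obtain ⟨l, hl⟩ := hp f
  refine ⟨(g' - l ∘ₗ Finsupp.linearCombination S (id : V → V)).codRestrict _ fun x => ?_,
    fun x => Subtype.ext ?_⟩
  · rw [LinearMap.mem_ker, ← LinearMap.comp_apply, LinearMap.comp_sub, ← LinearMap.comp_assoc, hl,
      hf, sub_self, LinearMap.zero_apply]
  · change g' x - l (Finsupp.linearCombination S (id : V → V) x) = g x
    rw [LinearMap.mem_ker.1 x.2, map_zero, sub_zero, hg']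
    rfl

theorem evalMap_lift (f : V →ₗ[S] X) :
    ∃ f' : V →ₗ[S] (V →ₗ[S] X) →₀ V, evalMap S V X ∘ₗ f' = f :=
  ⟨Finsupp.lsingle f, by ext; simp [evalMap]⟩

/-- Every map from V lifts along the universal map, so its kernel lies in V^{⊥₁}, and it embeds in a
coproduct of copies of V. -/
theorem IsGenProjective.isGenBy_ker_evalMap (hV : IsGenProjective S V) (hV' : IsSubClosed S V) :
    IsGenBy S V (LinearMap.ker (evalMap S V X)) :=
  hV' _ _ (LinearMap.ker (evalMap S V X)).subtype (Submodule.injective_subtype _)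
    (isGenBy_finsupp _) ((hV _ (isGenBy_finsupp _)).ker_of_lift _ evalMap_lift)

/-- Quasi-tilting modules that generate each other are summands of coproducts of copies of each
other. -/
theorem IsGenProjective.exists_section (hV : IsGenProjective S V) (hV' : IsSubClosed S V)
    (hW : IsGenProjective S V') (h : IsGenBy S V V') (h' : IsGenBy S V' V) :
    ∃ s : V' →ₗ[S] (V →ₗ[S] V') →₀ V, evalMap S V V' ∘ₗ s = LinearMap.id :=
  -- The kernel is generated by V, hence by V', so V' has no Ext¹ against it and the identity of V'
  -- lifts.
  (hW _ (h'.trans (hV.isGenBy_ker_evalMap hV'))).lift_ker h.evalMap_surjective _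

theorem exists_finset_le_supported {I : Type u} (N : Submodule S (I →₀ V)) (hN : N.FG) :
    ∃ J : Finset I, N ≤ Finsupp.supported V S (J : Set I) := by
  classical
  obtain ⟨s, rfl⟩ := hN
  refine ⟨s.biUnion Finsupp.support, Submodule.span_le.2 fun x hx => ?_⟩
  rw [SetLike.mem_coe, Finsupp.mem_supported]
  exact Finset.coe_subset.2 (Finset.subset_biUnion_of_mem Finsupp.support hx)

/-- Finitely presented modules generated by `V` are finitely presented by `V`. -/
theorem IsGenProjective.exists_presentation [Module.FinitePresentation S V]
    [Module.FinitePresentation S M] (hV : IsGenProjective S V) (hV' : IsSubClosed S V)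
    (hM : IsGenBy S V M) :
    ∃ (n : ℕ) (g : (Fin n → V) →ₗ[S] M), Function.Surjective g ∧
      IsGenBy S V (LinearMap.ker g) := by
  classical
  obtain ⟨n, q, hq⟩ := Module.Finite.exists_fin' S M
  have hK : (LinearMap.ker q).FG := Module.FinitePresentation.fg_ker q hq
  obtain ⟨s, hs⟩ := Module.projective_lifting_property (evalMap S V M) q hM.evalMap_surjective
  have hs' (x) : evalMap S V M (s x) = q x := LinearMap.congr_fun hs x
  have hgen : IsGenBy S V (LinearMap.ker (evalMap S V M)) := hV.isGenBy_ker_evalMap hV'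
  have hle : (LinearMap.ker q).map s ≤ LinearMap.ker (evalMap S V M) := by
    rintro _ ⟨x, hx, rfl⟩
    exact (hs' x).trans hx
  -- The relations of M, transported by s, form a finitely generated submodule of the kernel, so one
  -- finite power of V covers them.
  obtain ⟨κ, _, t, ht⟩ := exists_range_ge_of_fg (V := V)
    (((LinearMap.ker q).map s).comap (LinearMap.ker (evalMap S V M)).subtype)
    (Submodule.fg_of_fg_map_injective _ (Submodule.injective_subtype _)
      (by rw [Submodule.map_comap_subtype, inf_eq_right.2 hle]; exact hK.map s))
    (hgen.symm ▸ le_top)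
  -- Only finitely many copies of V are involved in s and t; the universal map is cut down to these
  -- copies.
  obtain ⟨J, hJ⟩ := exists_finset_le_supported
    (LinearMap.range s ⊔ LinearMap.range ((LinearMap.ker (evalMap S V M)).subtype ∘ₗ t))
    (by
      rw [LinearMap.range_eq_map, LinearMap.range_eq_map]
      exact ((Module.finite_def.1 inferInstance).map s).sup
        ((Module.finite_def.1 inferInstance).map _))
  let U := Finsupp.supported V S (J : Set (V →ₗ[S] M))
  let e : U ≃ₗ[S] (Fin (Fintype.card J) → V) :=
    (Finsupp.supportedEquivFinsupp (J : Set (V →ₗ[S] M))).trans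
      ((Finsupp.linearEquivFunOnFinite S V J).trans
        (LinearEquiv.funCongrLeft S V (Fintype.equivFin J).symm))
  let sU : (Fin n → S) →ₗ[S] U := s.codRestrict U fun x => hJ (Submodule.mem_sup_left ⟨x, rfl⟩)
  let tU : (κ → V) →ₗ[S] U :=
    ((LinearMap.ker (evalMap S V M)).subtype ∘ₗ t).codRestrict U
      fun x => hJ (Submodule.mem_sup_right ⟨x, rfl⟩)
  let π : U →ₗ[S] M := evalMap S V M ∘ₗ U.subtype
  have hπs (x) : π (sU x) = q x := hs' x
  have hπt (x) : π (tU x) = 0 := (t x).2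
  have hπ : Function.Surjective π := fun y => by
    obtain ⟨x, rfl⟩ := hq y
    exact ⟨sU x, hπs x⟩
  let K := LinearMap.range tU
  -- The image K of t contains the transported relations, so modulo K the map s becomes a section σ
  -- of ρ : U ⧸ K → M.
  obtain ⟨σ, hσ⟩ := exists_descend q hq (K.mkQ ∘ₗ sU) fun x hx => by
    obtain ⟨y, hy⟩ := ht (show (⟨s x, hle ⟨x, hx, rfl⟩⟩ : LinearMap.ker (evalMap S V M)) ∈ _ from
      ⟨x, hx, rfl⟩)
    refine (Submodule.Quotient.mk_eq_zero K).2 ⟨y, Subtype.ext ?_⟩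
    have := congrArg Subtype.val hy
    exact this
  let ρ : U ⧸ K →ₗ[S] M := K.liftQ π (by rintro _ ⟨x, rfl⟩; exact hπt x)
  have hρσ (y) : ρ (σ y) = y := by
    obtain ⟨x, rfl⟩ := hq y
    have : σ (q x) = K.mkQ (sU x) := LinearMap.congr_fun hσ x
    rw [this]
    exact hπs x
  let D : Submodule S U := (trace S V (LinearMap.ker π)).map (LinearMap.ker π).subtype
  have hU : IsGenBy S V U := (isGenBy_pi _).of_surjective e.symm.toLinearMap e.symm.surjective
  -- The kernel of ρ is the image of U under `K.mkQ - σ ∘ₗ π`, hence generated by V. As Ext¹(V, K) =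
  -- 0, maps from V into it lift to ker π, which is thus an extension of two modules generated by V
  -- whose generating maps all lift.
  have key : trace S V U ≤ (D.map K.mkQ).comap (K.mkQ - σ ∘ₗ π) := by
    rw [trace_le_iff]
    intro f v
    obtain ⟨l, hl⟩ := (hV _ ((isGenBy_pi κ).range tU)).lift_mkQ ((K.mkQ - σ ∘ₗ π) ∘ₗ f)
    have hl' (v) : K.mkQ (l v) = K.mkQ (f v) - σ (π (f v)) := LinearMap.congr_fun hl v
    have hlker (v) : l v ∈ LinearMap.ker π := by
      change ρ (K.mkQ (l v)) = 0
      rw [hl', map_sub, hρσ]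
      exact sub_self (π (f v))
    exact ⟨l v, ⟨l.codRestrict _ hlker v, apply_mem_trace _ v, rfl⟩, hl' v⟩
  have hKD : K ≤ D := by
    rintro _ ⟨x, rfl⟩
    exact ⟨tU.codRestrict (LinearMap.ker π) hπt x, map_mem_trace _ ((isGenBy_pi κ).mem x), rfl⟩
  have hker : IsGenBy S V (LinearMap.ker π) := by
    refine isGenBy_of_forall fun x => ?_
    have hx : π x = 0 := x.2
    obtain ⟨y, hy, hyx⟩ := key (hU.mem x)
    have hyx' : K.mkQ y = K.mkQ x := by simpa [hx] using hyx
    have hxD : (x : U) ∈ D := by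
      rw [← sub_add_cancel (x : U) y]
      exact add_mem (hKD ((Submodule.Quotient.eq K).1 hyx'.symm)) hy
    obtain ⟨z, hz, hzx⟩ := hxD
    rwa [← Subtype.ext hzx]
  refine ⟨_, π ∘ₗ e.symm.toLinearMap, hπ.comp e.symm.surjective, hker.of_surjective
    (((e.toLinearMap ∘ₗ (LinearMap.ker π).subtype)).codRestrict _ fun x => ?_) fun y => ?_⟩
  · have hx : π x = 0 := x.2
    simp [hx]
  · exact ⟨⟨e.symm y, y.2⟩, Subtype.ext (e.apply_symm_apply _)⟩

theorem IsGeneric.exists_extension {x₀ : V₀} (hx₀ : IsGeneric S V x₀) (hG : IsGenBy S V G) {n : ℕ}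
    (f : (Fin n → S) →ₗ[S] G) :
    ∃ f' : (Fin n → V₀) →ₗ[S] G,
      f' ∘ₗ (LinearMap.toSpanSingleton S V₀ x₀).compLeft (Fin n) = f := by
  choose h hh using fun j : Fin n => hx₀ G hG (f (Pi.single j 1))
  refine ⟨LinearMap.lsum S (fun _ => V₀) ℕ h, LinearMap.pi_ext' fun j => LinearMap.ext_ring ?_⟩
  simp only [LinearMap.comp_apply, LinearMap.lsum_apply, LinearMap.sum_apply,
    LinearMap.proj_apply, LinearMap.single_apply]
  rw [Finset.sum_eq_single j]
  · simp [hh]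
  · intro k _ hk
    simp [hk]
  · simp

/-- Finitely presented modules have semi-special preenvelopes by modules generated by `V`. -/
theorem IsGeneric.exists_preenvelope {x₀ : V₀} (hx₀ : IsGeneric S V x₀) (hV₀ : IsGenBy S V V₀)
    (hproj : ∀ (Z : Type u) [AddCommGroup Z] [Module S Z], IsGenBy S V Z → ExtVanish S V₀ Z)
    [Module.FinitePresentation S V₀] [Module.FinitePresentation S M] :
    ∃ (X : Type u) (_ : AddCommGroup X) (_ : Module S X), Module.FinitePresentation S X ∧
      IsGenBy S V X ∧ ∃ φ : M →ₗ[S] X,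
        (∀ (Z : Type u) [AddCommGroup Z] [Module S Z], IsGenBy S V Z →
          ∀ f : M →ₗ[S] Z, ∃ f' : X →ₗ[S] Z, f' ∘ₗ φ = f) ∧
        (∀ (C : Type u) [AddCommGroup C] [Module S C] (c : X →ₗ[S] C), Function.Exact φ c →
          Function.Surjective c → ∀ (Z : Type u) [AddCommGroup Z] [Module S Z],
            IsGenBy S V Z → ExtVanish S C Z) ∧
        ((∀ s : S, s • x₀ = 0 → s = 0) → Function.Injective φ) := by
  obtain ⟨n, q, hq⟩ := Module.Finite.exists_fin' S M
  have hq' : (LinearMap.ker q).FG := Module.FinitePresentation.fg_ker q hq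
  let a : (Fin n → S) →ₗ[S] (Fin n → V₀) :=
    (LinearMap.toSpanSingleton S V₀ x₀).compLeft (Fin n)
  -- The quotient of V₀^n by K is the pushout of a : S^n → V₀^n along q : S^n → M.
  let K := (LinearMap.ker q).map a
  obtain ⟨φ, hφ⟩ := exists_descend q hq (K.mkQ ∘ₗ a) fun x hx =>
    (Submodule.Quotient.mk_eq_zero K).2 ⟨x, hx, rfl⟩
  have hφ' (x) : φ (q x) = K.mkQ (a x) := LinearMap.congr_fun hφ x
  refine ⟨(Fin n → V₀) ⧸ K, inferInstance, inferInstance,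
    Module.finitePresentation_of_surjective K.mkQ K.mkQ_surjective
      (by rw [Submodule.ker_mkQ]; exact hq'.map a),
    (hV₀.trans (isGenBy_pi (Fin n))).of_surjective K.mkQ K.mkQ_surjective, φ, ?_, ?_, ?_⟩
  · intro Z _ _ hZ f
    obtain ⟨f', hf'⟩ := hx₀.exists_extension hZ (f ∘ₗ q)
    have hf'' (x) : f' (a x) = f (q x) := LinearMap.congr_fun hf' x
    refine ⟨K.liftQ f' ?_, LinearMap.ext fun y => ?_⟩
    · rintro _ ⟨x, hx, rfl⟩
      rw [LinearMap.mem_ker, hf'', LinearMap.mem_ker.1 hx, map_zero]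
    · obtain ⟨x, rfl⟩ := hq y
      rw [LinearMap.comp_apply, hφ']
      exact hf'' x
  · intro C _ _ c hc hc' Z _ _ hZ
    -- A pushout does not change the cokernel: C is also the cokernel of a, along which maps to Z
    -- extend.
    refine ((hproj Z hZ).pi (Fin n)).of_extends a (c ∘ₗ K.mkQ) (fun w => ?_)
      (hc'.comp K.mkQ_surjective) (hx₀.exists_extension hZ)
    refine (hc (K.mkQ w)).trans ⟨?_, ?_⟩
    · rintro ⟨y, hy⟩
      obtain ⟨x, rfl⟩ := hq y
      rw [hφ'] at hy
      obtain ⟨z, hz, hzw⟩ := (Submodule.Quotient.eq K).1 hy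
      exact ⟨x - z, by rw [map_sub, hzw, sub_sub_cancel]⟩
    · rintro ⟨x, rfl⟩
      exact ⟨q x, hφ' x⟩
  · intro h0
    have ha : Function.Injective a := by
      rw [← LinearMap.ker_eq_bot, LinearMap.ker_eq_bot']
      exact fun x hx => funext fun j => h0 _ (congrFun hx j)
    rw [← LinearMap.ker_eq_bot, LinearMap.ker_eq_bot']
    intro y hy
    obtain ⟨x, rfl⟩ := hq y
    rw [hφ'] at hy
    obtain ⟨z, hz, hzx⟩ := (Submodule.Quotient.mk_eq_zero K).1 hy
    rw [← ha hzx]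
    exact hz

end QuasiTilting

/-! ### Translation between categorical notions and linear maps -/

section ModuleCategory

variable {S : Type u} [Ring S]

theorem extOneVanishes_iff (X Y : ModuleCat.{u} S) : ExtOneVanishes X Y ↔ ExtVanish S X Y := by
  constructor
  · intro h E _ _ f g hf hfg hg
    have hS : (ShortComplex.mk (ModuleCat.ofHom f) (ModuleCat.ofHom g) (by
        ext x; exact hfg.apply_apply_eq_zero x)).ShortExact :=
      { exact := (ShortComplex.ShortExact.moduleCat_exact_iff_function_exact _).2 hfg
        mono_f := (ModuleCat.mono_iff_injective _).2 hf
        epi_g := (ModuleCat.epi_iff_surjective _).2 hg }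
    obtain ⟨s⟩ := h _ _ _ _ hS
    exact ⟨s.s.hom, LinearMap.ext fun x => congrArg (fun t : X ⟶ X => t.hom x) s.s_g⟩
  · intro h E f g w hS
    have := hS.mono_f
    have := hS.epi_g
    obtain ⟨s, hs⟩ := h E f.hom g.hom ((ModuleCat.mono_iff_injective f).1 hS.mono_f)
      ((ShortComplex.ShortExact.moduleCat_exact_iff_function_exact _).1 hS.exact)
      ((ModuleCat.epi_iff_surjective g).1 hS.epi_g)
    exact ⟨ShortComplex.Splitting.ofExactOfSection _ hS.exact (ModuleCat.ofHom s)
      (by ext x; exact LinearMap.congr_fun hs x) hS.mono_f⟩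

/-- The cofan of finitely supported functions. -/
noncomputable def finsuppCofan (V : ModuleCat.{u} S) (I : Type u) : Cofan fun _ : I => V :=
  Cofan.mk (ModuleCat.of S (I →₀ V)) fun i => ModuleCat.ofHom (Finsupp.lsingle i)

/-- The cofan of finitely supported functions is a colimit. -/
noncomputable def finsuppCofanIsColimit (V : ModuleCat.{u} S) (I : Type u) :
    IsColimit (finsuppCofan V I) :=
  Cofan.IsColimit.mk _ (fun s => ModuleCat.ofHom (Finsupp.lsum ℕ fun i => (s.inj i).hom))
    (fun s i => by
      ext x
      simp [finsuppCofan])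
    (fun s m hm => by
      apply ModuleCat.hom_ext
      refine Finsupp.lhom_ext' fun i => ?_
      ext x
      simp [← hm i, finsuppCofan]
      rfl)

/-- The cofan of functions on a finite type. -/
noncomputable def piCofan (V : ModuleCat.{u} S) (n : ℕ) : Cofan fun _ : Fin n => V :=
  Cofan.mk (ModuleCat.of S (Fin n → V))
    fun i => ModuleCat.ofHom (LinearMap.single S (fun _ => V) i)

/-- The cofan of functions on a finite type is a colimit. -/
noncomputable def piCofanIsColimit (V : ModuleCat.{u} S) (n : ℕ) : IsColimit (piCofan V n) :=
  Cofan.IsColimit.mk _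
    (fun s => ModuleCat.ofHom (LinearMap.lsum S (fun _ => V) ℕ fun i => (s.inj i).hom))
    (fun s i => by
      ext x
      exact LinearMap.lsum_piSingle S (fun _ => V) ℕ (fun i => (s.inj i).hom) i x)
    (fun s m hm => by
      apply ModuleCat.hom_ext
      refine LinearMap.pi_ext' fun i => ?_
      ext x
      refine .trans ?_ (LinearMap.lsum_piSingle S (fun _ => V) ℕ (fun i => (s.inj i).hom) i x).symm
      rw [← hm i]
      rfl)

theorem nonempty_retract_iff (X Y : ModuleCat.{u} S) :
    Nonempty (Retract X Y) ↔ ∃ (i : X →ₗ[S] Y) (r : Y →ₗ[S] X), r ∘ₗ i = LinearMap.id := by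
  constructor
  · rintro ⟨h⟩
    exact ⟨h.i.hom, h.r.hom, LinearMap.ext fun x => congrArg (fun t : X ⟶ X => t.hom x) h.retract⟩
  · rintro ⟨i, r, h⟩
    exact ⟨{ i := ModuleCat.ofHom i
             r := ModuleCat.ofHom r
             retract := by ext x; exact LinearMap.congr_fun h x }⟩

theorem add_iff (V X : ModuleCat.{u} S) :
    Add V X ↔ ∃ (I : Type u) (i : X →ₗ[S] (I →₀ V)) (r : (I →₀ V) →ₗ[S] X),
      r ∘ₗ i = LinearMap.id := by
  constructor
  · rintro ⟨I, c, ⟨hc⟩, ⟨h⟩⟩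
    exact ⟨I, (nonempty_retract_iff X (ModuleCat.of S (I →₀ V))).1
      ⟨h.trans (Retract.ofIso (hc.coconePointUniqueUpToIso (finsuppCofanIsColimit V I)))⟩⟩
  · rintro ⟨I, h⟩
    exact ⟨I, finsuppCofan V I, ⟨finsuppCofanIsColimit V I⟩,
      (nonempty_retract_iff X (ModuleCat.of S (I →₀ V))).2 h⟩

theorem finAdd_iff (V X : ModuleCat.{u} S) :
    finAdd V X ↔ ∃ (n : ℕ) (i : X →ₗ[S] (Fin n → V)) (r : (Fin n → V) →ₗ[S] X),
      r ∘ₗ i = LinearMap.id := by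
  constructor
  · rintro ⟨n, c, ⟨hc⟩, ⟨h⟩⟩
    exact ⟨n, (nonempty_retract_iff X (ModuleCat.of S (Fin n → V))).1
      ⟨h.trans (Retract.ofIso (hc.coconePointUniqueUpToIso (piCofanIsColimit V n)))⟩⟩
  · rintro ⟨n, h⟩
    exact ⟨n, piCofan V n, ⟨piCofanIsColimit V n⟩,
      (nonempty_retract_iff X (ModuleCat.of S (Fin n → V))).2 h⟩

theorem add_finsupp (V : ModuleCat.{u} S) (I : Type u) : Add V (ModuleCat.of S (I →₀ V)) :=
  (add_iff V _).2 ⟨I, LinearMap.id, LinearMap.id, rfl⟩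

theorem finAdd_pi (V : ModuleCat.{u} S) (n : ℕ) : finAdd V (ModuleCat.of S (Fin n → V)) :=
  (finAdd_iff V _).2 ⟨n, LinearMap.id, LinearMap.id, rfl⟩

theorem isGenBy_of_add {V X : ModuleCat.{u} S} (h : Add V X) : IsGenBy S V X := by
  obtain ⟨I, i, r, hir⟩ := (add_iff V X).1 h
  exact (isGenBy_finsupp I).of_surjective r
    (Function.LeftInverse.surjective (LinearMap.congr_fun hir))

theorem isGenBy_of_finAdd {V X : ModuleCat.{u} S} (h : finAdd V X) : IsGenBy S V X := by
  obtain ⟨n, i, r, hir⟩ := (finAdd_iff V X).1 h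
  exact (isGenBy_pi (Fin n)).of_surjective r
    (Function.LeftInverse.surjective (LinearMap.congr_fun hir))

theorem fp_of_finAdd {V X : ModuleCat.{u} S} [Module.FinitePresentation S V] (h : finAdd V X) :
    Module.FinitePresentation S X := by
  obtain ⟨n, i, r, hir⟩ := (finAdd_iff V X).1 h
  refine Module.finitePresentation_of_surjective r
    (Function.LeftInverse.surjective (LinearMap.congr_fun hir)) ?_
  have : LinearMap.ker r = LinearMap.range (LinearMap.id - i ∘ₗ r) := by
    ext x
    constructor
    · intro hx
      exact ⟨x, by simp [LinearMap.mem_ker.1 hx]⟩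
    · rintro ⟨y, rfl⟩
      have := LinearMap.congr_fun hir (r y)
      simp only [LinearMap.comp_apply, LinearMap.id_apply] at this
      simp [this]
  rw [this, LinearMap.range_eq_map]
  exact (Module.finite_def.1 inferInstance).map _

theorem ExtVanish.of_finAdd {V X : ModuleCat.{u} S} (h : finAdd V X) {Y : Type u} [AddCommGroup Y]
    [Module S Y] (hY : ExtVanish S V Y) : ExtVanish S X Y := by
  obtain ⟨n, i, r, hir⟩ := (finAdd_iff V X).1 h
  exact (hY.pi (Fin n)).of_retract i r hir

theorem gen_iff (V X : ModuleCat.{u} S) : Gen V X ↔ IsGenBy S V X := by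
  constructor
  · rintro ⟨Y, p, hY, hp⟩
    exact (isGenBy_of_add hY).of_surjective p.hom ((ModuleCat.epi_iff_surjective p).1 hp)
  · intro h
    exact ⟨_, ModuleCat.ofHom (evalMap S V X), add_finsupp V _,
      (ModuleCat.epi_iff_surjective _).2 h.evalMap_surjective⟩

theorem sub_gen_iff (V X : ModuleCat.{u} S) :
    Sub (Gen V) X ↔ ∃ (G : ModuleCat.{u} S) (i : X →ₗ[S] G), Function.Injective i ∧
      IsGenBy S V G := by
  constructor
  · rintro ⟨Y, i, hY, hi⟩
    exact ⟨Y, i.hom, (ModuleCat.mono_iff_injective i).1 hi, (gen_iff V Y).1 hY⟩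
  · rintro ⟨Y, i, hi, hY⟩
    exact ⟨Y, ModuleCat.ofHom i, (gen_iff V Y).2 hY, (ModuleCat.mono_iff_injective _).2 hi⟩

theorem IsQuasiTilting.isGenProjective {V : ModuleCat.{u} S} (h : IsQuasiTilting V) :
    IsGenProjective S V := by
  obtain ⟨T, F, -, h₁, -, h₂⟩ := h
  intro Z _ _ hZ
  have : Gen V (ModuleCat.of S Z) := (gen_iff V _).2 hZ
  rw [← h₁, h₂] at this
  exact (extOneVanishes_iff _ _).1 this.2

theorem IsQuasiTilting.isSubClosed {V : ModuleCat.{u} S} (h : IsQuasiTilting V) :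
    IsSubClosed S V := by
  obtain ⟨T, F, -, h₁, -, h₂⟩ := h
  intro X G _ _ _ _ i hi hG hX
  have : (Sub (Gen V) ⊓ rightExtOrthogonal V) (ModuleCat.of S X) :=
    ⟨(sub_gen_iff V _).2 ⟨ModuleCat.of S G, i, hi, hG⟩, (extOneVanishes_iff _ _).2 hX⟩
  rw [← h₂, h₁] at this
  exact (gen_iff V _).1 this

/-- Exact sequences `Y → Z → X → 0` exhibit `X` as a cokernel. -/
noncomputable def cokernelIsoOfExact {X Y Z : ModuleCat.{u} S} (f : Y ⟶ Z) (g : Z ⟶ X)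
    (hfg : Function.Exact f.hom g.hom) (hg : Function.Surjective g.hom) : cokernel f ≅ X :=
  have : Epi g := (ModuleCat.epi_iff_surjective g).2 hg
  let C := ShortComplex.mk f g (by ext x; exact hfg.apply_apply_eq_zero x)
  have hC : C.Exact := (ShortComplex.ShortExact.moduleCat_exact_iff_function_exact C).2 hfg
  have : Epi C.g := this
  (cokernelIsCokernel f).coconePointUniqueUpToIso hC.gIsCokernel

theorem cokernel_surjective {X Y : ModuleCat.{u} S} (f : X ⟶ Y) :
    Function.Surjective (cokernel.π f).hom :=
  (ModuleCat.epi_iff_surjective _).1 inferInstance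

theorem isTorsionPair_gen {V : ModuleCat.{u} S} (hV : IsGenProjective S V) :
    IsTorsionPair (Gen V) (homOrthogonal V) := by
  have hquot (X : ModuleCat.{u} S) : homOrthogonal V (ModuleCat.of S (X ⧸ trace S V X)) :=
    fun f => ModuleCat.hom_ext (hV.eq_zero_of_quotient_trace f.hom)
  have hzero {X Y : ModuleCat.{u} S} (hX : IsGenBy S V X) (hY : homOrthogonal V Y) (f : X ⟶ Y) :
      f = 0 := by
    ext x
    have : trace S V X ≤ LinearMap.ker f.hom := by
      rw [trace_le_iff]
      exact fun g v => congrArg (fun t : V ⟶ Y => t.hom v) (hY (ModuleCat.ofHom g ≫ f))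
    exact this (hX.mem x)
  refine ⟨?_, ?_, fun X => ?_⟩
  · ext Y
    constructor
    · exact fun h f => h f ((gen_iff V V).2 isGenBy_self)
    · exact fun h X f hX => hzero ((gen_iff V X).1 hX) h f
  · ext X
    constructor
    · intro h
      have h0 := h (ModuleCat.ofHom (trace S V X).mkQ) (hquot X)
      refine (gen_iff V X).2 (isGenBy_of_forall fun x => ?_)
      exact (Submodule.Quotient.mk_eq_zero _).1
        (congrArg (fun t : X ⟶ ModuleCat.of S (X ⧸ trace S V X) => t.hom x) h0)
    · exact fun h Y f hY => hzero ((gen_iff V X).1 h) hY f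
  · refine ⟨ModuleCat.of S (trace S V X), ModuleCat.of S (X ⧸ trace S V X),
      ModuleCat.ofHom (trace S V X).subtype, ModuleCat.ofHom (trace S V X).mkQ, ?_,
      (gen_iff V _).2 isGenBy_trace, hquot X, ?_⟩
    · ext x
      exact (Submodule.Quotient.mk_eq_zero _).2 x.2
    · exact
        { exact := (ShortComplex.ShortExact.moduleCat_exact_iff_function_exact _).2
            (LinearMap.exact_subtype_mkQ _)
          mono_f := (ModuleCat.mono_iff_injective _).2 (Submodule.injective_subtype _)
          epi_g := (ModuleCat.epi_iff_surjective _).2 (Submodule.mkQ_surjective _) }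

/-- The remaining requirement Gen(V) ⊆ Pres(V) holds because the kernel of the universal map is
again covered by a coproduct of copies of V. -/
theorem isQuasiTilting_of_isSubClosed {V : ModuleCat.{u} S} (hV : IsGenProjective S V)
    (hV' : IsSubClosed S V) : IsQuasiTilting V := by
  refine ⟨Gen V, homOrthogonal V, isTorsionPair_gen hV, rfl, ?_, ?_⟩
  · ext X
    rw [gen_iff]
    constructor
    · intro h
      have hK := hV.isGenBy_ker_evalMap (X := X) hV'
      refine ⟨_, _, ModuleCat.ofHom ((LinearMap.ker (evalMap S V X)).subtype ∘ₗ
        evalMap S V (LinearMap.ker (evalMap S V X))), add_finsupp V _, add_finsupp V _,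
        ⟨cokernelIsoOfExact _ (ModuleCat.ofHom (evalMap S V X)) ?_ h.evalMap_surjective⟩⟩
      rw [LinearMap.exact_iff]
      simp [LinearMap.range_comp, LinearMap.range_eq_top.2 hK.evalMap_surjective]
    · rintro ⟨Y, Z, f, -, hZ, ⟨e⟩⟩
      exact ((isGenBy_of_add hZ).of_surjective _ (cokernel_surjective f)).of_surjective e.hom.hom
        e.toLinearEquiv.surjective
  · ext X
    constructor
    · intro h
      rw [gen_iff] at h
      exact ⟨(sub_gen_iff V X).2 ⟨X, LinearMap.id, Function.injective_id, h⟩,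
        (extOneVanishes_iff V X).2 (hV X h)⟩
    · rintro ⟨h, h'⟩
      obtain ⟨G, i, hi, hG⟩ := (sub_gen_iff V X).1 h
      exact (gen_iff V X).2 (hV' X G i hi hG ((extOneVanishes_iff V X).1 h'))

theorem finPres_fp {V X : ModuleCat.{u} S} [Module.FinitePresentation S V] (h : finPres V X) :
    Module.FinitePresentation S X := by
  obtain ⟨Y, Z, f, hY, hZ, ⟨e⟩⟩ := h
  have := fp_of_finAdd hY
  have := fp_of_finAdd hZ
  have hc : Module.FinitePresentation S (cokernel f : ModuleCat.{u} S) := by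
    refine Module.finitePresentation_of_surjective _ (cokernel_surjective f) ?_
    have hex := (ShortComplex.ShortExact.moduleCat_exact_iff_function_exact _).1
      (ShortComplex.exact_cokernel f)
    have : LinearMap.ker (cokernel.π f).hom = LinearMap.range f.hom := LinearMap.exact_iff.1 hex
    rw [this, LinearMap.range_eq_map]
    exact (Module.finite_def.1 inferInstance).map _
  exact Module.FinitePresentation.of_equiv e.toLinearEquiv

/-- In a presentation V^n → X with kernel generated by V, the kernel is also finitely generated, so
a second finite power of V covers it. -/
theorem finPres_iff {V X : ModuleCat.{u} S} [Module.FinitePresentation S V]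
    [Module.FinitePresentation S X] (hV : IsGenProjective S V) (hV' : IsSubClosed S V) :
    finPres V X ↔ IsGenBy S V X := by
  constructor
  · rintro ⟨Y, Z, f, -, hZ, ⟨e⟩⟩
    exact ((isGenBy_of_finAdd hZ).of_surjective _ (cokernel_surjective f)).of_surjective e.hom.hom
      e.toLinearEquiv.surjective
  · intro h
    obtain ⟨n, g, hg, hK⟩ := hV.exists_presentation hV' h
    have hfg : Module.Finite S (LinearMap.ker g) :=
      Module.Finite.iff_fg.2 (Module.FinitePresentation.fg_ker g hg)
    obtain ⟨κ, _, t, ht⟩ := hK.exists_surjective_pi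
    have := Fintype.ofFinite κ
    let e := LinearEquiv.funCongrLeft S V (Fintype.equivFin κ)
    refine ⟨_, _, ModuleCat.ofHom ((LinearMap.ker g).subtype ∘ₗ t ∘ₗ e.toLinearMap),
      finAdd_pi V _, finAdd_pi V _, ⟨cokernelIsoOfExact _ (ModuleCat.ofHom g) ?_ hg⟩⟩
    rw [LinearMap.exact_iff]
    simp [LinearMap.range_comp, LinearMap.range_eq_top.2 ht]

end ModuleCategory

/-! ### Closure properties of torsion classes -/

section TorsionClass

variable {A : Type u} [Category.{v} A] [Abelian A] {T : ObjectProperty A}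

theorem IsTorsionClass.of_epi (hT : IsTorsionClass T) {X Y : A} (f : X ⟶ Y) [Epi f] (hX : T X) :
    T Y := by
  obtain ⟨F, hF⟩ := hT
  rw [← hF.left_eq] at hX ⊢
  intro Z g hZ
  rw [← cancel_epi f, hX (f ≫ g) hZ, comp_zero]

theorem IsTorsionClass.of_shortExact (hT : IsTorsionClass T) {C : ShortComplex A}
    (hC : C.ShortExact) (h₁ : T C.X₁) (h₃ : T C.X₃) : T C.X₂ := by
  obtain ⟨F, hF⟩ := hT
  rw [← hF.left_eq] at h₁ h₃ ⊢
  intro Z g hZ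
  have := hC.epi_g
  obtain ⟨l, hl⟩ := hC.exact.desc' g (h₁ _ hZ)
  rw [← hl, h₃ l hZ, comp_zero]

end TorsionClass

/-! ### The category mod-R and its comparison with Mod-R -/

section FinitelyPresented

variable {R : Type u} [Ring R]

/-- Finitely presented modules as objects of `mod-R`. -/
abbrev FPMod.of (R : Type u) [Ring R] (M : Type u) [AddCommGroup M] [Module Rᵐᵒᵖ M]
    [h : Module.FinitePresentation Rᵐᵒᵖ M] : FPMod R :=
  ⟨ModuleCat.of Rᵐᵒᵖ M, h⟩

/-- The linear map underlying a morphism in `mod-R`. -/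
abbrev FPMod.lin {X Y : FPMod R} (f : X ⟶ Y) : X.obj →ₗ[Rᵐᵒᵖ] Y.obj := f.hom.hom

/-- The morphism in `mod-R` given by a linear map. -/
abbrev FPMod.ofLin {X Y : FPMod R} (f : X.obj →ₗ[Rᵐᵒᵖ] Y.obj) : X ⟶ Y :=
  ObjectProperty.homMk (ModuleCat.ofHom f)

theorem FPMod.lin_ext {X Y : FPMod R} {f g : X ⟶ Y} (h : lin f = lin g) : f = g :=
  ObjectProperty.hom_ext _ (ModuleCat.hom_ext h)

instance (X : FPMod R) : Module.FinitePresentation Rᵐᵒᵖ X.obj := X.property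

theorem FPMod.epi_iff {X Y : FPMod R} (f : X ⟶ Y) : Epi f ↔ Function.Surjective (lin f) := by
  have := (isFP R).preservesEpimorphisms_ι_of_isNormalMonoCategory
  rw [← (isFP R).ι.epi_map_iff_epi]
  exact ModuleCat.epi_iff_surjective _

theorem toFP_gen_iff {V : RMod R} {X : FPMod R} : toFP (Gen V) X ↔ IsGenBy Rᵐᵒᵖ V X.obj :=
  gen_iff V X.obj

/-- Take x₀ to be the tuple of generators of V over End(V). An element of a module in Gen(V) is the
image of some y in a finite power of V, and each coordinate of y is an End(V)-combination of the
entries of x₀. -/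
theorem IsFinendo.exists_isGeneric {V : RMod R} (h : IsFinendo V) :
    ∃ (n : ℕ) (x₀ : Fin n → V), IsGeneric Rᵐᵒᵖ V x₀ := by
  have : Module.Finite (Module.End Rᵐᵒᵖ V) V := h
  obtain ⟨n, x₀, hx₀⟩ := Module.Finite.exists_fin (R := Module.End Rᵐᵒᵖ V) (M := V)
  refine ⟨n, x₀, fun Z _ _ hZ z => ?_⟩
  obtain ⟨ι, _, g, y, rfl⟩ := hZ.exists_eq_apply z
  have hy (i : ι) : ∃ c : Fin n → Module.End Rᵐᵒᵖ V, ∑ j, c j • x₀ j = y i :=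
    (Submodule.mem_span_range_iff_exists_fun _).1 (hx₀ ▸ Submodule.mem_top)
  choose c hc using hy
  refine ⟨g ∘ₗ LinearMap.pi fun i => ∑ j, c i j ∘ₗ LinearMap.proj j, ?_⟩
  rw [LinearMap.comp_apply]
  congr 1
  ext i
  simp [← hc i]

/-- View V₀ as a summand of V^n: the coordinates of x₀ generate V over End(V), since each v in V is
the image of x₀ under some map V₀ → V. -/
theorem IsGeneric.isFinendo {V V₀ : RMod R} {x₀ : V₀} (hx₀ : IsGeneric Rᵐᵒᵖ V x₀)
    (hV₀ : finAdd V V₀) : IsFinendo V := by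
  obtain ⟨n, i, r, hir⟩ := (finAdd_iff V V₀).1 hV₀
  classical
  refine ⟨⟨Finset.univ.image (i x₀), top_unique fun v _ => ?_⟩⟩
  obtain ⟨h, hh⟩ := hx₀ V isGenBy_self v
  have : v = ∑ j, ((h ∘ₗ r ∘ₗ LinearMap.single Rᵐᵒᵖ (fun _ => (V : Type u)) j :
      Module.End Rᵐᵒᵖ V)) • i x₀ j := by
    simp only [Module.End.smul_def, LinearMap.comp_apply, LinearMap.single_apply]
    rw [← map_sum, ← map_sum, Finset.univ_sum_single]
    have : r (i x₀) = x₀ := LinearMap.congr_fun hir x₀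
    rw [this, hh]
  rw [this]
  exact sum_mem fun j _ => Submodule.smul_mem _ _ (Submodule.subset_span
    (Finset.mem_coe.2 (Finset.mem_image_of_mem _ (Finset.mem_univ j))))

theorem IsGeneric.isSubClosed {V V₀ V₁ : RMod R} {x₀ : V₀} (hx₀ : IsGeneric Rᵐᵒᵖ V x₀)
    (hV₀ : finAdd V V₀) (hV₁ : finAdd V V₁) (p : V₀ →ₗ[Rᵐᵒᵖ] V₁) (hp : Function.Surjective p)
    (hker : Rᵐᵒᵖ ∙ x₀ = LinearMap.ker p) : IsSubClosed Rᵐᵒᵖ V :=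
  fun _ _ _ _ _ _ i hi hG hX =>
    hx₀.isGenBy_of_injective (isGenBy_of_finAdd hV₀) p hp hker i hi hG (hX.of_finAdd hV₁)

theorem toFP_gen_eq_of_add_eq {V W : RMod R} (h : Add V = Add W) :
    toFP (Gen V) = toFP (Gen W) := by
  unfold Gen
  rw [h]

theorem FPMod.cokernel_surjective {X Y : FPMod R} (f : X ⟶ Y) :
    Function.Surjective (lin (cokernel.π f)) :=
  (epi_iff _).1 inferInstance

theorem toFP_finPres {V : RMod R} (hfp : isFP R V) (hV : IsGenProjective Rᵐᵒᵖ V)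
    (hV' : IsSubClosed Rᵐᵒᵖ V) : toFP (finPres V) = toFP (Gen V) := by
  have : Module.FinitePresentation Rᵐᵒᵖ V := hfp
  ext X
  rw [toFP_gen_iff]
  exact finPres_iff (X := X.obj) hV hV'

variable [IsRightCoherent R]

instance : (isFP R).ι.PreservesHomology where
  preservesKernels _ _ f := (isFP R).preservesKernels_ι f
  preservesCokernels _ _ f := (isFP R).preservesCokernels_ι f

theorem FPMod.exact_iff (C : ShortComplex (FPMod R)) :
    C.Exact ↔ Function.Exact (lin C.f) (lin C.g) := by
  rw [← C.exact_map_iff_of_faithful (isFP R).ι,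
    ShortComplex.ShortExact.moduleCat_exact_iff_function_exact]
  rfl

theorem FPMod.mono_iff {X Y : FPMod R} (f : X ⟶ Y) : Mono f ↔ Function.Injective (lin f) := by
  have := (isFP R).preservesMonomorphisms_ι_of_isNormalEpiCategory
  rw [← (isFP R).ι.mono_map_iff_mono]
  exact ModuleCat.mono_iff_injective _

theorem FPMod.shortExact_iff (C : ShortComplex (FPMod R)) :
    C.ShortExact ↔ Function.Injective (lin C.f) ∧ Function.Exact (lin C.f) (lin C.g) ∧
      Function.Surjective (lin C.g) := by
  rw [← mono_iff, ← epi_iff, ← exact_iff]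
  exact ⟨fun h => ⟨h.mono_f, h.exact, h.epi_g⟩,
    fun h => { exact := h.2.1, mono_f := h.1, epi_g := h.2.2 }⟩

/-- Extensions of finitely presented modules are finitely presented, so Ext¹ vanishes in mod-R
exactly when it does in Mod-R. -/
theorem FPMod.extOneVanishes_iff (X Y : FPMod R) :
    ExtOneVanishes X Y ↔ ExtVanish Rᵐᵒᵖ X.obj Y.obj := by
  constructor
  · intro h E _ _ f g hf hfg hg
    have : Module.FinitePresentation Rᵐᵒᵖ (LinearMap.ker g) := by
      rw [LinearMap.exact_iff.1 hfg]
      exact Module.FinitePresentation.of_equiv (LinearEquiv.ofInjective f hf)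
    have : Module.FinitePresentation Rᵐᵒᵖ E := Module.finitePresentation_of_ker g hg
    obtain ⟨s⟩ := h (FPMod.of R E) (ofLin f) (ofLin g)
      (lin_ext (LinearMap.ext hfg.apply_apply_eq_zero)) ((shortExact_iff _).2 ⟨hf, hfg, hg⟩)
    exact ⟨lin s.s, congrArg lin s.s_g⟩
  · intro h E f g w hC
    obtain ⟨hf, hfg, hg⟩ := (shortExact_iff _).1 hC
    obtain ⟨s, hs⟩ := h E.obj (lin f) (lin g) hf hfg hg
    exact ⟨ShortComplex.Splitting.ofExactOfSection _ hC.exact (ofLin s) (lin_ext hs) hC.mono_f⟩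

theorem FPMod.cokernel_exact {X Y : FPMod R} (f : X ⟶ Y) :
    Function.Exact (lin f) (lin (cokernel.π f)) :=
  (exact_iff _).1 (ShortComplex.exact_cokernel f)

theorem IsTorsionClass.of_isGenBy {T : ObjectProperty (FPMod R)} (hT : IsTorsionClass T)
    {V X : FPMod R} (hV : T V) (hX : IsGenBy Rᵐᵒᵖ V.obj X.obj) : T X := by
  obtain ⟨F, hF⟩ := hT
  rw [← hF.left_eq] at hV ⊢
  intro Y f hY
  apply FPMod.lin_ext
  ext x
  have : trace Rᵐᵒᵖ V.obj X.obj ≤ LinearMap.ker (FPMod.lin f) := by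
    rw [trace_le_iff]
    exact fun g v => congrArg (fun t => FPMod.lin t v) (hV (FPMod.ofLin g ≫ f) hY)
  exact this (hX.mem x)

/-- Semi-special preenvelopes from a generic element of a module in `add(V)`. -/
theorem IsGeneric.exists_semiSpecialPreenvelope {V V₀ : RMod R} {x₀ : V₀}
    (hx₀ : IsGeneric Rᵐᵒᵖ V x₀) (hfp : isFP R V) (hV : IsGenProjective Rᵐᵒᵖ V)
    (hV₀ : finAdd V V₀) (M : FPMod R) :
    ∃ (X : FPMod R) (φ : M ⟶ X), IsSemiSpecialPreenvelope (toFP (Gen V)) φ ∧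
      ((∀ s : Rᵐᵒᵖ, s • x₀ = 0 → s = 0) → Mono φ) := by
  have : Module.FinitePresentation Rᵐᵒᵖ V := hfp
  have : Module.FinitePresentation Rᵐᵒᵖ V₀ := fp_of_finAdd hV₀
  obtain ⟨X, _, _, hX, hgen, φ, h₁, h₂, h₃⟩ := hx₀.exists_preenvelope (M := M.obj)
    (isGenBy_of_finAdd hV₀) fun Z _ _ hZ => (hV Z hZ).of_finAdd hV₀
  let ψ : M ⟶ FPMod.of R X := FPMod.ofLin φ
  refine ⟨FPMod.of R X, ψ, ⟨⟨toFP_gen_iff.2 hgen, fun Y hY g => ?_⟩,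
    fun Y hY => ?_⟩, fun h => (FPMod.mono_iff _).2 (h₃ h)⟩
  · obtain ⟨f', hf'⟩ := h₁ Y.obj (toFP_gen_iff.1 hY) (FPMod.lin g)
    exact ⟨FPMod.ofLin f', FPMod.lin_ext hf'⟩
  · exact (FPMod.extOneVanishes_iff _ _).2 (h₂ _ _ (FPMod.cokernel_exact ψ)
      (FPMod.cokernel_surjective ψ) _ (toFP_gen_iff.1 hY))

/-- Both modules are finitely presented and so belong to the common class; hence they generate each
other and W splits off a coproduct of copies of V. -/
theorem add_le_of_toFP_gen_eq {V W : RMod R} (hV : QuasiTiltingModules R V)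
    (hW : QuasiTiltingModules R W) (h : toFP (Gen V) = toFP (Gen W)) : Add W ≤ Add V := by
  have hVW : IsGenBy Rᵐᵒᵖ V W := by
    have : toFP (Gen W) ⟨W, hW.1⟩ := toFP_gen_iff.2 isGenBy_self
    rw [← h] at this
    exact toFP_gen_iff.1 this
  have hWV : IsGenBy Rᵐᵒᵖ W V := by
    have : toFP (Gen V) ⟨V, hV.1⟩ := toFP_gen_iff.2 isGenBy_self
    rw [h] at this
    exact toFP_gen_iff.1 this
  obtain ⟨s, hs⟩ := hV.2.2.1.isGenProjective.exists_section hV.2.2.1.isSubClosed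
    hW.2.2.1.isGenProjective hVW hWV
  intro X hX
  obtain ⟨I, i, r, hir⟩ := (add_iff W X).1 hX
  let e := Finsupp.curryLinearEquiv Rᵐᵒᵖ (α := I) (β := V →ₗ[Rᵐᵒᵖ] W) (M := V)
  refine (add_iff V X).2 ⟨I × (V →ₗ[Rᵐᵒᵖ] W),
    e.symm.toLinearMap ∘ₗ Finsupp.mapRange.linearMap s ∘ₗ i,
    r ∘ₗ Finsupp.mapRange.linearMap (evalMap Rᵐᵒᵖ V W) ∘ₗ e.toLinearMap, ?_⟩
  ext x
  have h1 : Finsupp.mapRange.linearMap (evalMap Rᵐᵒᵖ V W)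
      (Finsupp.mapRange.linearMap s (i x)) = i x := by
    ext j
    exact LinearMap.congr_fun hs (i x j)
  simp only [LinearMap.comp_apply, LinearEquiv.coe_coe, LinearEquiv.apply_symm_apply, h1]
  exact LinearMap.congr_fun hir x

end FinitelyPresented

/-! ### From tilting modules to torsion classes and back -/

section Bijections

variable {R : Type u} [Ring R]

theorem IsGeneric.finendo_and_quasiTilting {V V₀ V₁ : RMod R} {x₀ : V₀}
    (hx₀ : IsGeneric Rᵐᵒᵖ V x₀) (hV : IsGenProjective Rᵐᵒᵖ V) (hV₀ : finAdd V V₀)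
    (hV₁ : finAdd V V₁) (p : V₀ →ₗ[Rᵐᵒᵖ] V₁) (hp : Function.Surjective p)
    (hker : Rᵐᵒᵖ ∙ x₀ = LinearMap.ker p) : IsFinendo V ∧ IsQuasiTilting V :=
  ⟨hx₀.isFinendo hV₀, isQuasiTilting_of_isSubClosed hV (hx₀.isSubClosed hV₀ hV₁ p hp hker)⟩

theorem finAdd_prod_left (X Y : RMod R) : finAdd (ModuleCat.of Rᵐᵒᵖ (X × Y)) X :=
  (finAdd_iff _ _).2 ⟨1, LinearMap.pi fun _ => LinearMap.inl Rᵐᵒᵖ X Y,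
    LinearMap.fst Rᵐᵒᵖ X Y ∘ₗ LinearMap.proj 0, rfl⟩

theorem finAdd_prod_right (X Y : RMod R) : finAdd (ModuleCat.of Rᵐᵒᵖ (X × Y)) Y :=
  (finAdd_iff _ _).2 ⟨1, LinearMap.pi fun _ => LinearMap.inr Rᵐᵒᵖ X Y,
    LinearMap.snd Rᵐᵒᵖ X Y ∘ₗ LinearMap.proj 0, rfl⟩

/-- The right module `R`, as a module over `Rᵐᵒᵖ`. -/
def opLinearEquiv (R : Type u) [Ring R] : R ≃ₗ[Rᵐᵒᵖ] Rᵐᵒᵖ :=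
  { MulOpposite.opAddEquiv with map_smul' := fun _ _ => rfl }

theorem IsClassicalTilting.fp {V : RMod R} (h : IsClassicalTilting V) : isFP R V := by
  obtain ⟨P₁, P₀, f, g, w, ⟨_, _⟩, ⟨_, _⟩, hC⟩ := h.exists_resolution
  have hfg : Function.Exact f.hom g.hom :=
    (ShortComplex.ShortExact.moduleCat_exact_iff_function_exact _).1 hC.exact
  have : Module.FinitePresentation Rᵐᵒᵖ P₀ := Module.finitePresentation_of_projective _ _
  refine Module.finitePresentation_of_surjective g.hom
    ((ModuleCat.epi_iff_surjective g).1 hC.epi_g) ?_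
  rw [LinearMap.exact_iff.1 hfg, LinearMap.range_eq_map]
  exact (Module.finite_def.1 inferInstance).map _

/-- A map from the first syzygy to Z in Gen(V) has finitely generated image, so by projectivity of
the syzygy it factors through a finite power of V. There it extends to P₀ coordinatewise by Ext¹(V,
V) = 0. -/
theorem IsClassicalTilting.isGenProjective {V : RMod R} (h : IsClassicalTilting V) :
    IsGenProjective Rᵐᵒᵖ V := by
  classical
  obtain ⟨P₁, P₀, f, g, w, ⟨_, _⟩, ⟨_, _⟩, hC⟩ := h.exists_resolution
  have hfg : Function.Exact f.hom g.hom :=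
    (ShortComplex.ShortExact.moduleCat_exact_iff_function_exact _).1 hC.exact
  have hf : Function.Injective f.hom := (ModuleCat.mono_iff_injective f).1 hC.mono_f
  let e : P₁ ≃ₗ[Rᵐᵒᵖ] LinearMap.ker g.hom :=
    (LinearEquiv.ofInjective f.hom hf).trans (LinearEquiv.ofEq _ _ (LinearMap.exact_iff.1 hfg).symm)
  have hg := (ModuleCat.epi_iff_surjective g).1 hC.epi_g
  have : Module.Finite Rᵐᵒᵖ (LinearMap.ker g.hom) := Module.Finite.equiv e
  have : Module.Projective Rᵐᵒᵖ (LinearMap.ker g.hom) := Module.Projective.of_equiv e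
  have hVV : ExtVanish Rᵐᵒᵖ V V := (extOneVanishes_iff V V).1 h.ext_self
  intro Z _ _ hZ
  refine extVanish_of_extend g.hom hg fun k => ?_
  obtain ⟨ι, _, a, ha⟩ := exists_range_ge_of_fg (V := V) (LinearMap.range k)
    (by rw [LinearMap.range_eq_map]; exact (Module.finite_def.1 inferInstance).map _)
    (hZ.symm ▸ le_top)
  obtain ⟨l, hl⟩ := Module.projective_lifting_property a.rangeRestrict
    (k.codRestrict (LinearMap.range a) fun x => ha ⟨x, rfl⟩) a.surjective_rangeRestrict
  choose m hm using fun i => hVV.extend g.hom hg _ rfl (LinearMap.proj i ∘ₗ l)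
  refine ⟨a ∘ₗ LinearMap.pi m, fun x => ?_⟩
  have h1 : LinearMap.pi m x = l x := funext fun i => hm i x
  rw [LinearMap.comp_apply, h1]
  exact congrArg Subtype.val (LinearMap.congr_fun hl x)

/-- The generic element is the image of 1 in the coresolution of R: the cokernel V₁ lies in add(V),
so maps from R to Gen(V) extend to V₀. -/
theorem IsClassicalTilting.exists_isGeneric {V : RMod R} (h : IsClassicalTilting V) :
    ∃ (V₀ V₁ : RMod R) (x₀ : V₀) (p : V₀ →ₗ[Rᵐᵒᵖ] V₁), finAdd V V₀ ∧ finAdd V V₁ ∧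
      IsGeneric Rᵐᵒᵖ V x₀ ∧ Function.Surjective p ∧ Rᵐᵒᵖ ∙ x₀ = LinearMap.ker p ∧
        ∀ s : Rᵐᵒᵖ, s • x₀ = 0 → s = 0 := by
  obtain ⟨V₀, V₁, f, g, w, hV₀, hV₁, hC⟩ := h.exists_coresolution
  have hfg : Function.Exact f.hom g.hom :=
    (ShortComplex.ShortExact.moduleCat_exact_iff_function_exact _).1 hC.exact
  have hf : Function.Injective f.hom := (ModuleCat.mono_iff_injective f).1 hC.mono_f
  have hg := (ModuleCat.epi_iff_surjective g).1 hC.epi_g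
  let e := opLinearEquiv R
  let f' : Rᵐᵒᵖ →ₗ[Rᵐᵒᵖ] V₀ := f.hom ∘ₗ e.symm.toLinearMap
  have hf' : Function.Injective f' := hf.comp e.symm.injective
  have hs (s : Rᵐᵒᵖ) : s • f' 1 = f' s := by rw [← map_smul, smul_eq_mul, mul_one]
  have hker : Rᵐᵒᵖ ∙ f' 1 = LinearMap.ker g.hom := by
    rw [LinearMap.exact_iff.1 hfg]
    ext x
    rw [Submodule.mem_span_singleton]
    constructor
    · rintro ⟨s, rfl⟩
      exact ⟨e.symm s, (hs s).symm⟩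
    · rintro ⟨s, rfl⟩
      refine ⟨e s, (hs _).trans ?_⟩
      change f.hom (e.symm (e s)) = _
      rw [e.symm_apply_apply]
  refine ⟨V₀, V₁, f' 1, g.hom, hV₀, hV₁, fun Z _ _ hZ z => ?_, hg, hker, fun s h0 => ?_⟩
  · let e' : Rᵐᵒᵖ ≃ₗ[Rᵐᵒᵖ] LinearMap.ker g.hom :=
      (LinearEquiv.ofInjective f' hf').trans (LinearEquiv.ofEq _ _ (by
        rw [LinearMap.exact_iff.1 hfg]
        exact LinearMap.range_comp_of_range_eq_top _ (LinearEquiv.range _)))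
    obtain ⟨k, hk⟩ := ((h.isGenProjective Z hZ).of_finAdd hV₁).extend g.hom hg _ rfl
      (LinearMap.toSpanSingleton Rᵐᵒᵖ Z z ∘ₗ e'.symm.toLinearMap)
    refine ⟨k, ?_⟩
    have h1 : (e' 1 : V₀) = f' 1 := rfl
    rw [← h1, hk]
    simp
  · exact hf' (by rw [← hs, h0, map_zero])

variable {T : ObjectProperty (FPMod R)} {T₀ : FPMod R} {φ : FPMod.of R Rᵐᵒᵖ ⟶ T₀}

theorem IsPreenvelope.exists_apply_eq (hφ : IsPreenvelope T φ) {X : FPMod R} (hX : T X)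
    (x : X.obj) : ∃ h : T₀ ⟶ X, FPMod.lin h (FPMod.lin φ (1 : Rᵐᵒᵖ)) = x := by
  obtain ⟨h, hh⟩ := hφ.exists_factor X hX
    (FPMod.ofLin (X := FPMod.of R Rᵐᵒᵖ) (LinearMap.toSpanSingleton Rᵐᵒᵖ X.obj x))
  refine ⟨h, ?_⟩
  have := congrArg (fun t : FPMod.of R Rᵐᵒᵖ ⟶ X => FPMod.lin t (1 : Rᵐᵒᵖ)) hh
  exact this.trans (one_smul Rᵐᵒᵖ x)

/-- The module of a semi-special preenvelope of `R` and its cokernel. -/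
noncomputable abbrev tiltingModule (φ : FPMod.of R Rᵐᵒᵖ ⟶ T₀) : RMod R :=
  ModuleCat.of Rᵐᵒᵖ (T₀.obj × (cokernel φ).obj)

theorem isFP_tiltingModule (φ : FPMod.of R Rᵐᵒᵖ ⟶ T₀) : isFP R (tiltingModule φ) :=
  Module.FinitePresentation.prod _ _

variable [IsRightCoherent R]

theorem ClassicalTiltingModules.quasiTiltingModules {V : RMod R}
    (h : ClassicalTiltingModules R V) : QuasiTiltingModules R V := by
  obtain ⟨V₀, V₁, x₀, p, hV₀, hV₁, hx₀, hp, hker, -⟩ := h.1.exists_isGeneric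
  obtain ⟨h₁, h₂⟩ := hx₀.finendo_and_quasiTilting h.1.isGenProjective hV₀ hV₁ p hp hker
  exact ⟨h.1.fp, h₁, h₂, h.2⟩

theorem QuasiTiltingModules.mem_semiSpecial {V : RMod R} (h : QuasiTiltingModules R V) :
    toFP (Gen V) ∈ SemiSpecialTorsionClasses R := by
  obtain ⟨n, x₀, hx₀⟩ := h.2.1.exists_isGeneric
  refine ⟨⟨_, h.2.2.2⟩, fun M => ?_⟩
  obtain ⟨X, φ, hφ, -⟩ := IsGeneric.exists_semiSpecialPreenvelope
    (V₀ := ModuleCat.of Rᵐᵒᵖ (Fin n → V)) hx₀ h.1 h.2.2.1.isGenProjective (finAdd_pi V n) M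
  exact ⟨X, φ, hφ⟩

theorem ClassicalTiltingModules.mem_special {V : RMod R} (h : ClassicalTiltingModules R V) :
    toFP (Gen V) ∈ SpecialTorsionClasses R := by
  obtain ⟨V₀, V₁, x₀, p, hV₀, hV₁, hx₀, hp, hker, h0⟩ := h.1.exists_isGeneric
  refine ⟨⟨_, h.2⟩, fun M => ?_⟩
  obtain ⟨X, φ, hφ, hmono⟩ := hx₀.exists_semiSpecialPreenvelope h.1.fp h.1.isGenProjective hV₀ M
  exact ⟨X, φ, ⟨hφ, hmono h0⟩⟩

theorem add_eq_of_toFP_gen_eq {V W : RMod R} (hV : QuasiTiltingModules R V)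
    (hW : QuasiTiltingModules R W) (h : toFP (Gen V) = toFP (Gen W)) : Add V = Add W :=
  le_antisymm (add_le_of_toFP_gen_eq hW hV h.symm) (add_le_of_toFP_gen_eq hV hW h)

theorem span_eq_ker_cokernel (φ : FPMod.of R Rᵐᵒᵖ ⟶ T₀) :
    Rᵐᵒᵖ ∙ FPMod.lin φ (1 : Rᵐᵒᵖ) = LinearMap.ker (FPMod.lin (cokernel.π φ)) := by
  rw [LinearMap.exact_iff.1 (FPMod.cokernel_exact φ)]
  ext x
  rw [Submodule.mem_span_singleton]
  constructor
  · rintro ⟨s, rfl⟩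
    exact ⟨s • (1 : Rᵐᵒᵖ), map_smul (FPMod.lin φ) s (1 : Rᵐᵒᵖ)⟩
  · rintro ⟨s, rfl⟩
    exact ⟨s, (map_smul (FPMod.lin φ) s (1 : Rᵐᵒᵖ)).symm.trans
      (congrArg (FPMod.lin φ) (mul_one (s : Rᵐᵒᵖ)))⟩

/-- In an extension E of T₀ by X, which lies in T, lift φ(1) to y and choose h : T₀ → E taking φ(1)
to y. The error id - g ∘ h kills φ(1), so it factors through Coker φ, where Ext¹ vanishes; lifting
it to E corrects h to a section. -/
theorem IsSemiSpecialPreenvelope.extVanish_left (hT : IsTorsionClass T)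
    (hφ : IsSemiSpecialPreenvelope T φ) {X : FPMod R} (hX : T X) :
    ExtVanish Rᵐᵒᵖ T₀.obj X.obj := by
  rw [← FPMod.extOneVanishes_iff]
  intro E f g w hC
  have hE : T E := hT.of_shortExact hC hX hφ.mem
  obtain ⟨hf, hfg, hg⟩ := (FPMod.shortExact_iff _).1 hC
  obtain ⟨y, hy⟩ := hg (FPMod.lin φ (1 : Rᵐᵒᵖ))
  obtain ⟨h, hh⟩ := hφ.exists_apply_eq hE y
  obtain ⟨δ, hδ⟩ := exists_descend (FPMod.lin (cokernel.π φ)) (FPMod.cokernel_surjective φ)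
    (LinearMap.id - FPMod.lin (h ≫ g)) (by
      rw [← span_eq_ker_cokernel, Submodule.span_singleton_le_iff_mem, LinearMap.mem_ker]
      change _ - FPMod.lin g (FPMod.lin h _) = 0
      rw [hh]
      exact sub_eq_zero.2 hy.symm)
  obtain ⟨d, hd⟩ := ((FPMod.extOneVanishes_iff _ _).1 (hφ.cokernel_mem X hX)).lift
    (FPMod.lin f) (FPMod.lin g) hf hfg hg δ
  refine ⟨ShortComplex.Splitting.ofExactOfSection _ hC.exact
    (h + FPMod.ofLin (d ∘ₗ FPMod.lin (cokernel.π φ))) (FPMod.lin_ext ?_) hC.mono_f⟩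
  ext x
  have h1 : FPMod.lin g (d (FPMod.lin (cokernel.π φ) x)) = δ (FPMod.lin (cokernel.π φ) x) :=
    LinearMap.congr_fun hd _
  have h2 : δ (FPMod.lin (cokernel.π φ) x) = x - FPMod.lin g (FPMod.lin h x) :=
    LinearMap.congr_fun hδ x
  change FPMod.lin g (FPMod.lin h x + d (FPMod.lin (cokernel.π φ) x)) = x
  rw [map_add, h1, h2, add_sub_cancel]

theorem IsSemiSpecialPreenvelope.extVanish (hT : IsTorsionClass T)
    (hφ : IsSemiSpecialPreenvelope T φ) {X : FPMod R} (hX : T X) :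
    ExtVanish Rᵐᵒᵖ (tiltingModule φ) X.obj :=
  (hφ.extVanish_left hT hX).prod ((FPMod.extOneVanishes_iff _ _).1 (hφ.cokernel_mem X hX))

theorem IsSemiSpecialPreenvelope.isGenBy (hφ : IsSemiSpecialPreenvelope T φ) {X : FPMod R}
    (hX : T X) : IsGenBy Rᵐᵒᵖ (tiltingModule φ) X.obj := by
  refine isGenBy_of_forall fun x => ?_
  obtain ⟨h, rfl⟩ := hφ.exists_apply_eq hX x
  exact map_mem_trace (FPMod.lin h) ((isGenBy_of_finAdd (finAdd_prod_left _ _)).mem _)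

theorem IsSemiSpecialPreenvelope.toFP_gen (hT : IsTorsionClass T)
    (hφ : IsSemiSpecialPreenvelope T φ) : toFP (Gen (tiltingModule φ)) = T := by
  ext X
  rw [toFP_gen_iff]
  refine ⟨fun h => ?_, hφ.isGenBy⟩
  refine hT.of_isGenBy hφ.mem (IsGenBy.trans ?_ h)
  refine isGenBy_of_forall fun x => ?_
  have h1 : x = LinearMap.inl Rᵐᵒᵖ T₀.obj (cokernel φ).obj x.1 +
    LinearMap.inr Rᵐᵒᵖ T₀.obj (cokernel φ).obj x.2 := by simp
  rw [h1]
  exact add_mem (apply_mem_trace _ _) (map_mem_trace _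
    ((isGenBy_self.of_surjective _ (FPMod.cokernel_surjective φ)).mem _))

theorem IsSemiSpecialPreenvelope.mem_of_isGenBy (hT : IsTorsionClass T)
    (hφ : IsSemiSpecialPreenvelope T φ) {X : FPMod R}
    (hX : IsGenBy Rᵐᵒᵖ (tiltingModule φ) X.obj) : T X := by
  rw [← hφ.toFP_gen hT]
  exact toFP_gen_iff.2 hX

/-- Coherence makes the syzygy finitely presented, so its maps to an arbitrary Z in Gen(V) factor
through a finitely presented module generated by V. That module lies in T, where the vanishing is
known. -/
theorem IsSemiSpecialPreenvelope.isGenProjective (hT : IsTorsionClass T)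
    (hφ : IsSemiSpecialPreenvelope T φ) : IsGenProjective Rᵐᵒᵖ (tiltingModule φ) := by
  intro Z _ _ hZ
  have : Module.FinitePresentation Rᵐᵒᵖ (tiltingModule φ) := isFP_tiltingModule φ
  obtain ⟨n, q, hq⟩ := Module.Finite.exists_fin' Rᵐᵒᵖ (tiltingModule φ)
  have : Module.FinitePresentation Rᵐᵒᵖ (LinearMap.ker q) :=
    fp_of_fg_submodule IsRightCoherent.fp_of_fg_left _ (Module.FinitePresentation.fg_ker q hq)
  refine extVanish_of_extend q hq fun g => ?_
  obtain ⟨Y, _, _, _, hY, a, b, rfl⟩ := hZ.exists_factor g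
  obtain ⟨a', ha'⟩ := (hφ.extVanish hT (X := FPMod.of R Y) (hφ.mem_of_isGenBy hT hY)).extend q hq _
    rfl a
  exact ⟨b ∘ₗ a', fun x => congrArg b (ha' x)⟩

theorem IsSemiSpecialPreenvelope.isGeneric (hT : IsTorsionClass T)
    (hφ : IsSemiSpecialPreenvelope T φ) :
    IsGeneric Rᵐᵒᵖ (tiltingModule φ) (FPMod.lin φ (1 : Rᵐᵒᵖ)) := by
  intro Z _ _ hZ z
  have : Module.FinitePresentation Rᵐᵒᵖ (tiltingModule φ) := isFP_tiltingModule φ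
  obtain ⟨ι, _, g, y, rfl⟩ := hZ.exists_eq_apply z
  obtain ⟨h, hh⟩ := hφ.exists_apply_eq (X := FPMod.of R (ι → tiltingModule φ))
    (hφ.mem_of_isGenBy hT (isGenBy_pi ι)) y
  exact ⟨g ∘ₗ FPMod.lin h, congrArg g hh⟩

theorem IsSemiSpecialPreenvelope.quasiTiltingModules (hT : IsTorsionClass T)
    (hφ : IsSemiSpecialPreenvelope T φ) : QuasiTiltingModules R (tiltingModule φ) := by
  obtain ⟨h₁, h₂⟩ := (hφ.isGeneric hT).finendo_and_quasiTilting (hφ.isGenProjective hT)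
    (finAdd_prod_left _ _) (finAdd_prod_right _ _) _ (FPMod.cokernel_surjective φ)
    (span_eq_ker_cokernel φ)
  refine ⟨isFP_tiltingModule φ, h₁, h₂, ?_⟩
  have hV := hφ.toFP_gen hT
  obtain ⟨F, hF⟩ := hT
  -- The module lies in T and generates every object of T, so being orthogonal to it and being
  -- orthogonal to T agree on mod-R.
  have : toFP (homOrthogonal (tiltingModule φ)) = F := by
    rw [← hF.right_eq]
    ext Y
    constructor
    · intro hY X f hX
      apply FPMod.lin_ext
      ext x
      have : trace Rᵐᵒᵖ (tiltingModule φ) X.obj ≤ LinearMap.ker (FPMod.lin f) := by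
        rw [trace_le_iff]
        exact fun g v => LinearMap.congr_fun
          (congrArg ModuleCat.Hom.hom (hY (ModuleCat.ofHom g ≫ f.hom))) v
      exact this ((hφ.isGenBy hX).mem x)
    · intro hY f
      have hmem : T ⟨tiltingModule φ, isFP_tiltingModule φ⟩ := by
        rw [← hV]
        exact toFP_gen_iff.2 isGenBy_self
      exact congrArg (fun t => t.hom) (hY (ObjectProperty.homMk f) hmem)
  rw [TorsionPairRestricts, hV, this]
  exact hF

end Bijections

/-! ### Wakamatsu's lemma and envelopes in Krull-Schmidt categories -/

section Envelopes

attribute [local instance] Abelian.hasFiniteBiproducts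

variable {A : Type u} [Category.{v} A] [Abelian A] {T : ObjectProperty A}

theorem shortExact_pullback {Y E C X : A} {f : Y ⟶ E} {g : E ⟶ C} (w : f ≫ g = 0)
    (hC : (ShortComplex.mk f g w).ShortExact) (p : X ⟶ C) :
    (ShortComplex.mk (pullback.lift f 0 (by rw [w, zero_comp]) : Y ⟶ pullback g p)
      (pullback.snd g p) (pullback.lift_snd _ _ _)).ShortExact := by
  have : Mono f := hC.mono_f
  have : Epi g := hC.epi_g
  have hm : Mono (pullback.lift f 0 (by rw [w, zero_comp]) : Y ⟶ pullback g p) :=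
    mono_of_mono_fac (pullback.lift_fst f 0 _)
  refine { exact := ?_, mono_f := hm, epi_g := by dsimp; infer_instance }
  refine ShortComplex.exact_of_f_is_kernel _ (KernelFork.IsLimit.ofι' _ _ fun {W} k hk => ?_)
  have hk' : (k ≫ pullback.fst g p) ≫ g = 0 := by
    rw [Category.assoc, pullback.condition, reassoc_of% hk, zero_comp]
  refine ⟨hC.exact.lift _ hk', ?_⟩
  apply pullback.hom_ext
  · rw [Category.assoc]
    dsimp only
    rw [pullback.lift_fst]
    exact hC.exact.lift_f (k ≫ pullback.fst g p) hk'
  · rw [Category.assoc]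
    dsimp only
    rw [pullback.lift_snd, comp_zero]
    exact hk.symm

/-- Wakamatsu's lemma. -/
theorem IsEnvelope.isSemiSpecialPreenvelope (hT : IsTorsionClass T) {M X : A} {φ : M ⟶ X}
    (hφ : IsEnvelope T φ) : IsSemiSpecialPreenvelope T φ := by
  refine ⟨hφ.toIsPreenvelope, fun Y hY E f g w hC => ?_⟩
  let P := pullback g (cokernel.π φ)
  have hP : T P := hT.of_shortExact (shortExact_pullback w hC (cokernel.π φ)) hY hφ.mem
  -- The pair (0, φ) factors as φ followed by h : X ⟶ P. Minimality makes the X-component α of h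
  -- invertible; after normalising by its inverse, the E-component kills φ and descends to a section
  -- on the cokernel.
  let m : M ⟶ P := pullback.lift 0 φ (by simp)
  obtain ⟨h, hh⟩ := hφ.exists_factor P hP m
  let α : X ⟶ X := h ≫ pullback.snd g (cokernel.π φ)
  have hα : φ ≫ α = φ := by
    rw [← Category.assoc, hh]
    exact pullback.lift_snd _ _ _
  have : IsIso α := hφ.left_minimal α hα
  have hα' : φ ≫ inv α = φ := by rw [IsIso.comp_inv_eq, hα]
  have hs : φ ≫ inv α ≫ h ≫ pullback.fst g (cokernel.π φ) = 0 := by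
    rw [reassoc_of% hα', reassoc_of% hh]
    exact pullback.lift_fst _ _ _
  refine ⟨ShortComplex.Splitting.ofExactOfSection _ hC.exact (cokernel.desc φ _ hs) ?_ hC.mono_f⟩
  rw [← cancel_epi (cokernel.π φ)]
  simp only [cokernel.π_desc_assoc, Category.assoc, pullback.condition, Category.comp_id]
  rw [← Category.assoc h, IsIso.inv_hom_id_assoc]

theorem IsPreenvelope.of_iso {M X X' : A} {φ : M ⟶ X} (hT : IsTorsionClass T)
    (hφ : IsPreenvelope T φ) (e : X ≅ X') : IsPreenvelope T (φ ≫ e.hom) where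
  mem := hT.of_epi e.hom hφ.mem
  exists_factor Z hZ g := by
    obtain ⟨h, rfl⟩ := hφ.exists_factor Z hZ g
    exact ⟨e.inv ≫ h, by simp⟩

/-- The endomorphism e of Z is idempotent, hence 0 or 1 in a local ring; e = 0 would force t = 0 and
then 𝟙 Y = 0. -/
theorem isIso_of_isIso_comp {Y Z : A} [IsLocalRing (End Y)] [IsLocalRing (End Z)] (t : Y ⟶ Z)
    (w : Z ⟶ Y) [IsIso (t ≫ w)] : IsIso t := by
  let e : End Z := w ≫ inv (t ≫ w) ≫ t
  have hte : t ≫ (w ≫ inv (t ≫ w) ≫ t) = t := by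
    rw [← Category.assoc, IsIso.hom_inv_id_assoc]
  have he : e * (1 - e) = 0 := by
    have : e * e = e := by
      rw [End.mul_def]
      simp only [e, Category.assoc, hte]
    rw [mul_sub, mul_one, this, sub_self]
  rcases IsLocalRing.isUnit_or_isUnit_of_add_one (add_sub_cancel e 1) with h | h
  · have h1 : e = 1 := (sub_eq_zero.1 ((h.mul_right_eq_zero).1 he)).symm
    exact ⟨w ≫ inv (t ≫ w), by rw [← Category.assoc, IsIso.hom_inv_id],
      by rw [Category.assoc]; exact h1⟩
  · exfalso
    have h0 : e = 0 := (h.mul_left_eq_zero).1 he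
    have ht : t = 0 := by
      rw [← hte]
      exact (congrArg (t ≫ ·) h0).trans comp_zero
    have : (1 : End Y) = 0 := by
      change 𝟙 Y = 0
      rw [← IsIso.hom_inv_id (t ≫ w)]
      exact (congrArg (fun a => (a ≫ w) ≫ inv (t ≫ w)) ht).trans (by simp)
    exact one_ne_zero this

/-- Composing t back to Y never gives a unit, so 1 + c is invertible in the local ring End(Y).
Invertibility passes from 1 + bp on Y to 1 + pb on X by the usual formula 1 - p(1 + bp)⁻¹b. -/
theorem mem_jacobson_of_not_isIso {X Y Z : A} [IsLocalRing (End Y)] [IsLocalRing (End Z)]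
    (p : X ⟶ Y) (t : Y ⟶ Z) (i : Z ⟶ X) (ht : ¬ IsIso t) :
    End.of (p ≫ t ≫ i) ∈ Ideal.jacobson (⊥ : Ideal (End X)) := by
  rw [Ideal.mem_jacobson_iff]
  intro y
  let b : Y ⟶ X := t ≫ i ≫ y
  let c : End Y := b ≫ p
  have hc : ¬ IsUnit (-c) := by
    rw [IsUnit.neg_iff, isUnit_iff_isIso]
    intro h
    have : IsIso (t ≫ i ≫ y ≫ p) := by simpa [c, b] using h
    exact ht (isIso_of_isIso_comp t (i ≫ y ≫ p))
  have hc' : IsUnit (1 + c) :=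
    (IsLocalRing.isUnit_or_isUnit_of_add_one (show -c + (1 + c) = 1 by abel)).resolve_left hc
  obtain ⟨v, hv⟩ := hc'.exists_left_inv
  have hv' : (𝟙 Y + b ≫ p) ≫ (v : Y ⟶ Y) = 𝟙 Y := hv
  refine ⟨𝟙 X - p ≫ (v : Y ⟶ Y) ≫ b, ?_⟩
  rw [Ideal.mem_bot, sub_eq_zero]
  have hy : y * End.of (p ≫ t ≫ i) = End.of (p ≫ b) := by
    rw [End.mul_def]
    exact (by simp [b] : (p ≫ t ≫ i) ≫ y = p ≫ b)
  rw [mul_assoc, hy, End.mul_def]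
  change (p ≫ b) ≫ (𝟙 X - p ≫ v ≫ b) + (𝟙 X - p ≫ v ≫ b) = 𝟙 X
  have h2 : p ≫ ((𝟙 Y + b ≫ p) ≫ (v : Y ⟶ Y)) ≫ b = p ≫ b := by rw [hv', Category.id_comp]
  simp only [Preadditive.add_comp, Preadditive.comp_add, Category.id_comp, Category.assoc] at h2
  simp only [Preadditive.comp_sub, Category.comp_id, Category.assoc]
  rw [← h2]
  abel

/-- `T`-preenvelopes of `M` by a biproduct of `n` objects with local endomorphism rings. -/
def HasLocalPreenvelope (T : ObjectProperty A) (M : A) (n : ℕ) : Prop :=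
  ∃ (Y : Fin n → A) (φ : M ⟶ ⨁ Y), (∀ i, IsLocalRing (End (Y i))) ∧ IsPreenvelope T φ

/-- The summand Y j can be discarded: 1 - e fixes φ because φ ≫ θ = 0, and it kills the inclusion of
Y j because c is invertible, so φ is recovered from its components outside j. -/
theorem hasLocalPreenvelope_of_isIso (hT : IsTorsionClass T) {M : A} {n : ℕ} {Y : Fin (n + 1) → A}
    (hY : ∀ i, IsLocalRing (End (Y i))) {φ : M ⟶ ⨁ Y} (hφ : IsPreenvelope T φ)
    (θ : ⨁ Y ⟶ ⨁ Y) (hθ : φ ≫ θ = 0) (j i : Fin (n + 1))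
    [IsIso (biproduct.ι Y j ≫ θ ≫ biproduct.π Y i)] : HasLocalPreenvelope T M n := by
  let Y' : Fin n → A := fun k => Y (j.succAbove k)
  let p : ⨁ Y ⟶ ⨁ Y' := biproduct.lift fun k => biproduct.π Y (j.succAbove k)
  let q : ⨁ Y' ⟶ ⨁ Y := biproduct.desc fun k => biproduct.ι Y (j.succAbove k)
  have hpq : p ≫ q + biproduct.π Y j ≫ biproduct.ι Y j = 𝟙 _ := by
    rw [biproduct.lift_desc, ← biproduct.total, Fin.sum_univ_succAbove _ j]
    exact add_comm _ _
  have hqp : q ≫ p = 𝟙 _ := by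
    apply biproduct.hom_ext'
    intro k
    apply biproduct.hom_ext
    intro l
    by_cases hkl : k = l
    · subst hkl
      simp [p, q, Y']
    · simp [p, q, Y', biproduct.ι_π_ne _ hkl,
        biproduct.ι_π_ne Y ((Fin.succAbove_right_injective (p := j)).ne hkl)]
  have : Epi p := epi_of_epi_fac hqp
  let c := biproduct.ι Y j ≫ θ ≫ biproduct.π Y i
  let e : ⨁ Y ⟶ ⨁ Y := θ ≫ biproduct.π Y i ≫ inv c ≫ biproduct.ι Y j
  have hφe : φ ≫ (𝟙 _ - e) = φ := by
    simp [e, reassoc_of% hθ]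
  have hje : biproduct.ι Y j ≫ (𝟙 _ - e) = 0 := by
    have : biproduct.ι Y j ≫ e = c ≫ inv c ≫ biproduct.ι Y j := by simp only [c, e, Category.assoc]
    rw [Preadditive.comp_sub, this, IsIso.hom_inv_id_assoc, Category.comp_id, sub_self]
  have hφp : φ ≫ p ≫ q ≫ (𝟙 _ - e) = φ := by
    have h1 := congrArg (fun a => φ ≫ a ≫ (𝟙 _ - e)) hpq
    simpa only [Preadditive.add_comp, Category.assoc, hje, comp_zero, add_zero, Category.id_comp,
      hφe] using h1
  refine ⟨Y', φ ≫ p, fun k => hY _, hT.of_epi p hφ.mem, fun Z hZ g => ?_⟩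
  obtain ⟨h, rfl⟩ := hφ.exists_factor Z hZ g
  refine ⟨q ≫ (𝟙 _ - e) ≫ h, ?_⟩
  have := congrArg (· ≫ h) hφp
  simpa only [Category.assoc] using this

/-- By minimality of n no component of 1 - ψ is invertible, so 1 - ψ is a sum of elements of the
Jacobson radical. -/
theorem exists_comp_eq_id (hT : IsTorsionClass T) {M : A} {n : ℕ}
    (hn : ∀ m < n, ¬ HasLocalPreenvelope T M m) {Y : Fin n → A}
    (hY : ∀ i, IsLocalRing (End (Y i))) {φ : M ⟶ ⨁ Y} (hφ : IsPreenvelope T φ)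
    (ψ : ⨁ Y ⟶ ⨁ Y) (hψ : φ ≫ ψ = φ) : ∃ z : ⨁ Y ⟶ ⨁ Y, ψ ≫ z = 𝟙 _ := by
  let θ : ⨁ Y ⟶ ⨁ Y := 𝟙 _ - ψ
  have hθ : φ ≫ θ = 0 := by simp [θ, hψ]
  have hnot (j i : Fin n) : ¬ IsIso (biproduct.ι Y j ≫ θ ≫ biproduct.π Y i) := by
    intro h
    obtain ⟨m, rfl⟩ : ∃ m, n = m + 1 := ⟨n - 1, by have := j.2; omega⟩
    exact hn m (Nat.lt_succ_self m) (hasLocalPreenvelope_of_isIso hT hY hφ θ hθ j i)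
  have hsum : End.of θ = ∑ j, ∑ i, End.of (biproduct.π Y j ≫
      (biproduct.ι Y j ≫ θ ≫ biproduct.π Y i) ≫ biproduct.ι Y i) := by
    change θ = ∑ j, ∑ i, (biproduct.π Y j ≫
      (biproduct.ι Y j ≫ θ ≫ biproduct.π Y i) ≫ biproduct.ι Y i : ⨁ Y ⟶ ⨁ Y)
    have h1 : θ = (∑ j, biproduct.π Y j ≫ biproduct.ι Y j) ≫ θ ≫
      ∑ i, biproduct.π Y i ≫ biproduct.ι Y i := by
      rw [biproduct.total, Category.id_comp, Category.comp_id]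
    conv_lhs => rw [h1]
    simp only [Preadditive.sum_comp, Preadditive.comp_sum, Category.assoc]
    exact Finset.sum_comm
  have hmem : End.of θ ∈ Ideal.jacobson (⊥ : Ideal (End (⨁ Y))) := by
    rw [hsum]
    exact sum_mem fun j _ => sum_mem fun i _ => mem_jacobson_of_not_isIso _ _ _ (hnot j i)
  obtain ⟨z, hz⟩ := Ideal.mem_jacobson_iff.1 hmem (-1)
  rw [Ideal.mem_bot, sub_eq_zero, mul_neg_one, neg_mul, End.mul_def] at hz
  let z' : ⨁ Y ⟶ ⨁ Y := z
  have hz' : -(θ ≫ z') + z' = 𝟙 (⨁ Y) := hz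
  refine ⟨z', ?_⟩
  rw [← hz']
  simp [θ]

theorem exists_isEnvelope (hT : IsTorsionClass T) (hA : IsKrullSchmidt A) {M X : A} {φ : M ⟶ X}
    (hφ : IsPreenvelope T φ) : ∃ (X' : A) (φ' : M ⟶ X'), IsEnvelope T φ' := by
  classical
  have hex : ∃ n, HasLocalPreenvelope T M n := by
    obtain ⟨n, Y, hY, ⟨e⟩⟩ := hA X
    exact ⟨n, Y, φ ≫ (e.symm ≪≫ (biproduct.isoCoproduct Y).symm).hom, hY, hφ.of_iso hT _⟩
  obtain ⟨Y, φ', hY, hφ'⟩ := Nat.find_spec hex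
  refine ⟨_, φ', hφ', fun ψ hψ => ?_⟩
  have key := exists_comp_eq_id hT (fun m hm => Nat.find_min hex hm) hY hφ'
  obtain ⟨z, hz⟩ := key ψ hψ
  -- The one-sided inverse z also fixes the preenvelope, so it has a one-sided inverse too, which
  -- must be ψ.
  obtain ⟨w, hw⟩ := key z (by rw [← hψ, Category.assoc, hz, Category.comp_id, hψ])
  have hwψ : w = ψ := by
    rw [← Category.id_comp w, ← hz, Category.assoc, hw, Category.comp_id]
  exact ⟨z, hz, by rw [← hwψ, hw]⟩

theorem IsSpecialPreenveloping.isCogenerating (h : IsSpecialPreenveloping T) :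
    IsCogenerating T := by
  intro M
  obtain ⟨X, φ, hφ⟩ := h M
  exact ⟨X, φ, hφ.mem, hφ.mono⟩

theorem IsSpecialPreenveloping.isSemiSpecialPreenveloping (h : IsSpecialPreenveloping T) :
    IsSemiSpecialPreenveloping T := by
  intro M
  obtain ⟨X, φ, hφ⟩ := h M
  exact ⟨X, φ, hφ.toIsSemiSpecialPreenvelope⟩

theorem IsSemiSpecialPreenveloping.isPreenveloping (h : IsSemiSpecialPreenveloping T) :
    IsPreenveloping T := by
  intro M
  obtain ⟨X, φ, hφ⟩ := h M
  exact ⟨X, φ, hφ.toIsPreenvelope⟩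

theorem IsPreenveloping.isEnveloping (h : IsPreenveloping T) (hT : IsTorsionClass T)
    (hA : IsKrullSchmidt A) : IsEnveloping T := by
  intro M
  obtain ⟨X, φ, hφ⟩ := h M
  exact exists_isEnvelope hT hA hφ

theorem IsEnveloping.isSemiSpecialPreenveloping (h : IsEnveloping T) (hT : IsTorsionClass T) :
    IsSemiSpecialPreenveloping T := by
  intro M
  obtain ⟨X, φ, hφ⟩ := h M
  exact ⟨X, φ, hφ.isSemiSpecialPreenvelope hT⟩

theorem IsSemiSpecialPreenveloping.isSpecialPreenveloping (h : IsSemiSpecialPreenveloping T)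
    (hT : IsCogenerating T) : IsSpecialPreenveloping T := by
  intro M
  obtain ⟨X, φ, hφ⟩ := h M
  obtain ⟨Y, i, hY, hi⟩ := hT M
  obtain ⟨g, hg⟩ := hφ.exists_factor Y hY i
  have : Mono (φ ≫ g) := hg ▸ hi
  exact ⟨X, φ, hφ, mono_of_mono φ g⟩

end Envelopes

/-! ### Special preenveloping classes and the final bijections -/

section Classical

variable {R : Type u} [Ring R] [IsRightCoherent R] {T : ObjectProperty (FPMod R)}

/-- A syzygy of a module that is `Ext`-projective in a special preenveloping torsion class is
projective. -/
theorem projective_ker_of_isSpecialPreenveloping (hT : IsTorsionClass T)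
    (hT' : IsSpecialPreenveloping T) {V P : Type u} [AddCommGroup V] [Module Rᵐᵒᵖ V]
    [AddCommGroup P] [Module Rᵐᵒᵖ P] [Module.FinitePresentation Rᵐᵒᵖ V]
    [Module.Finite Rᵐᵒᵖ P] [Module.Projective Rᵐᵒᵖ P]
    (hV : ∀ X : FPMod R, T X → ExtVanish Rᵐᵒᵖ V X.obj) (q : P →ₗ[Rᵐᵒᵖ] V)
    (hq : Function.Surjective q) : Module.Projective Rᵐᵒᵖ (LinearMap.ker q) := by
  have : Module.Finite Rᵐᵒᵖ (LinearMap.ker q) :=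
    Module.Finite.iff_fg.2 (Module.FinitePresentation.fg_ker q hq)
  have : Module.FinitePresentation Rᵐᵒᵖ P := Module.finitePresentation_of_projective _ _
  have : Module.FinitePresentation Rᵐᵒᵖ (LinearMap.ker q) :=
    fp_of_fg_submodule IsRightCoherent.fp_of_fg_left _ (Module.FinitePresentation.fg_ker q hq)
  obtain ⟨k, r, hr⟩ := Module.Finite.exists_fin' Rᵐᵒᵖ (LinearMap.ker q)
  have hN : (LinearMap.ker r).FG := Module.FinitePresentation.fg_ker r hr
  obtain ⟨Y, ι, hι⟩ := hT' (FPMod.of R (Fin k → Rᵐᵒᵖ))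
  let i : (Fin k → Rᵐᵒᵖ) →ₗ[Rᵐᵒᵖ] Y.obj := FPMod.lin ι
  have hi : Function.Injective i := (FPMod.mono_iff ι).1 hι.mono
  -- Y ⧸ K is a quotient of Y, hence in T, and receives the syzygy; Ext-vanishing extends this map
  -- to P, and projectivity of P lifts it to l : P → Y.
  let K := (LinearMap.ker r).map i
  have : Module.FinitePresentation Rᵐᵒᵖ (Y.obj ⧸ K) :=
    Module.finitePresentation_of_surjective K.mkQ K.mkQ_surjective
      (by rw [Submodule.ker_mkQ]; exact hN.map i)
  have hK : T (FPMod.of R (Y.obj ⧸ K)) :=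
    hT.of_isGenBy hι.mem (isGenBy_self.of_surjective K.mkQ K.mkQ_surjective)
  obtain ⟨κ, hκ⟩ := exists_descend r hr (K.mkQ ∘ₗ i) fun x hx =>
    (Submodule.Quotient.mk_eq_zero K).2 ⟨x, hx, rfl⟩
  have hκ' (x) : κ (r x) = K.mkQ (i x) := LinearMap.congr_fun hκ x
  obtain ⟨κ', hκ'₂⟩ := (hV _ hK).extend q hq _ rfl κ
  obtain ⟨l, hl⟩ := Module.projective_lifting_property K.mkQ κ' K.mkQ_surjective
  have hl' (x) : K.mkQ (l x) = κ' x := LinearMap.congr_fun hl x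
  have hd (x) : (i - l ∘ₗ (LinearMap.ker q).subtype ∘ₗ r) x ∈ K := by
    rw [← Submodule.Quotient.mk_eq_zero]
    change K.mkQ (i x - l (r x)) = 0
    rw [map_sub, hl', hκ'₂, hκ', sub_self]
  let e := Submodule.equivMapOfInjective i hi (LinearMap.ker r)
  -- The map i - l ∘ r has values in K and equals i on ker r, so it gives a retraction onto ker r;
  -- hence r splits.
  let ρ : (Fin k → Rᵐᵒᵖ) →ₗ[Rᵐᵒᵖ] LinearMap.ker r :=
    e.symm.toLinearMap ∘ₗ LinearMap.codRestrict K _ hd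
  obtain ⟨s, hs⟩ := exists_descend r hr (LinearMap.id - (LinearMap.ker r).subtype ∘ₗ ρ)
    fun x hx => by
      have h1 : ρ x = ⟨x, hx⟩ := by
        change e.symm _ = _
        rw [LinearEquiv.symm_apply_eq]
        apply Subtype.ext
        change i x - l (r x) = i x
        rw [LinearMap.mem_ker.1 hx]
        simp
      simp [h1]
  refine Module.Projective.of_split s r (LinearMap.ext fun y => ?_)
  obtain ⟨x, rfl⟩ := hr y
  have h2 : s (r x) = x - ρ x := LinearMap.congr_fun hs x
  have h3 : r (ρ x) = 0 := (ρ x).2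
  simp [h2, h3]

/-- The resolution is a finite free cover with its projective syzygy; the coresolution is φ itself
with its cokernel, exact on the left because φ is mono. -/
theorem IsSpecialPreenvelope.isClassicalTilting (hT : IsTorsionClass T)
    (hT' : IsSpecialPreenveloping T) {T₀ : FPMod R} {φ : FPMod.of R Rᵐᵒᵖ ⟶ T₀}
    (hφ : IsSpecialPreenvelope T φ) : IsClassicalTilting (tiltingModule φ) where
  exists_resolution := by
    have : Module.FinitePresentation Rᵐᵒᵖ (tiltingModule φ) := isFP_tiltingModule φ
    obtain ⟨n, q, hq⟩ := Module.Finite.exists_fin' Rᵐᵒᵖ (tiltingModule φ)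
    refine ⟨ModuleCat.of _ (LinearMap.ker q), ModuleCat.of _ (Fin n → Rᵐᵒᵖ),
      ModuleCat.ofHom (LinearMap.ker q).subtype, ModuleCat.ofHom q, ?_,
      ⟨Module.Finite.iff_fg.2 (Module.FinitePresentation.fg_ker q hq),
        projective_ker_of_isSpecialPreenveloping hT hT' (fun X hX => hφ.extVanish hT hX) q hq⟩,
      ⟨inferInstance, inferInstance⟩, ?_⟩
    · exact ModuleCat.hom_ext (LinearMap.ext fun x => x.2)
    · exact
        { exact := (ShortComplex.ShortExact.moduleCat_exact_iff_function_exact _).2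
            (LinearMap.exact_subtype_ker_map q)
          mono_f := (ModuleCat.mono_iff_injective _).2 (Submodule.injective_subtype _)
          epi_g := (ModuleCat.epi_iff_surjective _).2 hq }
  ext_self := (extOneVanishes_iff _ _).2 (hφ.isGenProjective hT _ isGenBy_self)
  exists_coresolution := by
    have hex : Function.Exact (FPMod.lin φ ∘ₗ (opLinearEquiv R).toLinearMap)
        (FPMod.lin (cokernel.π φ)) := by
      rw [LinearMap.exact_iff, LinearMap.exact_iff.1 (FPMod.cokernel_exact φ)]
      exact (LinearMap.range_comp_of_range_eq_top _ (LinearEquiv.range _)).symm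
    refine ⟨T₀.obj, (cokernel φ).obj,
      ModuleCat.ofHom (FPMod.lin φ ∘ₗ (opLinearEquiv R).toLinearMap), (cokernel.π φ).hom, ?_,
      finAdd_prod_left _ _, finAdd_prod_right _ _, ?_⟩
    · exact ModuleCat.hom_ext (LinearMap.ext hex.apply_apply_eq_zero)
    · exact
        { exact := (ShortComplex.ShortExact.moduleCat_exact_iff_function_exact _).2 hex
          mono_f := (ModuleCat.mono_iff_injective _).2
            (((FPMod.mono_iff φ).1 hφ.mono).comp (opLinearEquiv R).injective)
          epi_g := (ModuleCat.epi_iff_surjective _).2 (FPMod.cokernel_surjective φ) }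

/-- The assignment `[V] ↦ Gen(V) ∩ mod-R`. -/
def genMap {P : ObjectProperty (RMod R)} {C : Set (ObjectProperty (FPMod R))}
    (hP : ∀ V, P V → toFP (Gen V) ∈ C) : EquivClasses P → C :=
  Quotient.lift (fun V => ⟨toFP (Gen V.1), hP V.1 V.2⟩)
    fun _ _ h => Subtype.ext (toFP_gen_eq_of_add_eq h)

theorem genMap_bijective {P : ObjectProperty (RMod R)} {C : Set (ObjectProperty (FPMod R))}
    (hP : ∀ V, P V → toFP (Gen V) ∈ C) (hP' : P ≤ QuasiTiltingModules R)
    (hC : ∀ T ∈ C, ∃ V, P V ∧ toFP (Gen V) = T) : Function.Bijective (genMap hP) := by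
  constructor
  · rintro ⟨V⟩ ⟨W⟩ h
    exact Quotient.sound (add_eq_of_toFP_gen_eq (hP' _ V.2) (hP' _ W.2) (congrArg Subtype.val h))
  · rintro ⟨T, hT⟩
    obtain ⟨V, hV, rfl⟩ := hC T hT
    exact ⟨EquivClasses.mk V hV, rfl⟩

theorem QuasiTiltingModules.finPres_le {V : RMod R} (h : QuasiTiltingModules R V) :
    finPres V ≤ isFP R := by
  have : Module.FinitePresentation Rᵐᵒᵖ V := h.1
  exact fun X hX => finPres_fp hX

theorem QuasiTiltingModules.toFP_finPres {V : RMod R} (h : QuasiTiltingModules R V) :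
    toFP (Gen V) = toFP (finPres V) :=
  (TiltingTheory.toFP_finPres h.1 h.2.2.1.isGenProjective h.2.2.1.isSubClosed).symm

end Classical

end TiltingTheory

theorem mainTheorem9 (R : Type u) [Ring R] [IsRightCoherent R] :
    (∃ Φ : EquivClasses (QuasiTiltingModules R) → SemiSpecialTorsionClasses R,
      Function.Bijective Φ ∧
      ∀ (V : RMod R) (hV : QuasiTiltingModules R V),
        finPres V ≤ isFP R ∧ (Φ (EquivClasses.mk V hV)).1 = toFP (finPres V)) ∧
    (∃ Ψ : EquivClasses (ClassicalTiltingModules R) → SpecialTorsionClasses R,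
      Function.Bijective Ψ ∧
      ∀ (V : RMod R) (hV : ClassicalTiltingModules R V),
        finPres V ≤ isFP R ∧ (Ψ (EquivClasses.mk V hV)).1 = toFP (finPres V)) ∧
    (IsKrullSchmidt (FPMod R) → ∀ T : ObjectProperty (FPMod R), IsTorsionClass T →
      (IsSemiSpecialPreenveloping T ↔ IsPreenveloping T) ∧
      (IsSemiSpecialPreenveloping T ↔ IsEnveloping T) ∧
      (IsSpecialPreenveloping T ↔ IsCogenerating T ∧ IsPreenveloping T) ∧
      (IsSpecialPreenveloping T ↔ IsCogenerating T ∧ IsEnveloping T)) := by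
  -- The maps are built from Gen(V) ∩ mod-R and only then identified with pres(V). Surjectivity
  -- needs just the preenvelope of the regular module.
  refine ⟨⟨genMap fun _ => QuasiTiltingModules.mem_semiSpecial,
    genMap_bijective _ le_rfl fun T hT => ?_, fun V hV => ⟨hV.finPres_le, hV.toFP_finPres⟩⟩,
    ⟨genMap fun _ => ClassicalTiltingModules.mem_special,
    genMap_bijective _ (fun _ => ClassicalTiltingModules.quasiTiltingModules) fun T hT => ?_,
    fun V hV => ⟨hV.quasiTiltingModules.finPres_le, hV.quasiTiltingModules.toFP_finPres⟩⟩,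
    fun hR T hT => ?_⟩
  · obtain ⟨T₀, φ, hφ⟩ := hT.2 (FPMod.of R Rᵐᵒᵖ)
    exact ⟨_, hφ.quasiTiltingModules hT.1, hφ.toFP_gen hT.1⟩
  · obtain ⟨T₀, φ, hφ⟩ := hT.2 (FPMod.of R Rᵐᵒᵖ)
    exact ⟨_, ⟨hφ.isClassicalTilting hT.1 hT.2, (hφ.quasiTiltingModules hT.1).2.2.2⟩,
      hφ.toFP_gen hT.1⟩
  · have h₁ : IsPreenveloping T → IsEnveloping T := fun h => h.isEnveloping hT hR
    have h₂ : IsEnveloping T → IsSemiSpecialPreenveloping T :=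
      fun h => h.isSemiSpecialPreenveloping hT
    have h₃ : IsSemiSpecialPreenveloping T → IsPreenveloping T := fun h => h.isPreenveloping
    have h₄ (h : IsSpecialPreenveloping T) : IsCogenerating T ∧ IsPreenveloping T :=
      ⟨h.isCogenerating, h₃ h.isSemiSpecialPreenveloping⟩
    have h₅ (h : IsCogenerating T ∧ IsEnveloping T) : IsSpecialPreenveloping T :=
      (h₂ h.2).isSpecialPreenveloping h.1
    exact ⟨⟨h₃, fun h => h₂ (h₁ h)⟩, ⟨fun h => h₁ (h₃ h), h₂⟩,
      ⟨h₄, fun h => h₅ ⟨h.1, h₁ h.2⟩⟩, ⟨fun h => ⟨(h₄ h).1, h₁ (h₄ h).2⟩, h₅⟩⟩
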